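/- Let $n\ge 1$, $\gamma>0$, let $M$ be a real skew-symmetric $n\times n$ matrix, and consider on $\mathbb{R}^n$ the mass-critical rotational nonlinear Schrödinger equation $$ i u_t = -\Delta u + \gamma^2|x|^2 u - |u|^{4/n}u + i\,(Mx)\cdot\nabla u. \tag{1} $$ Let $Q\in H^1(\mathbb{R}^n)$ be the ground state, i.e. the positive radial function of class $C^2$ with $-Q=-\Delta Q-Q^{1+4/n}$. For a function $\varphi(t,x)$ define its $\mathcal{R}$-transform by $$ \mathcal{R}\varphi(t,x)=\frac{1}{\cos^{n/2}(2\gamma t)}\,e^{-i\frac{\gamma}{2}|x|^2\tan(2\gamma t)}\,\varphi\Big(\frac{\tan(2\gamma t)}{2\gamma},\frac{e^{tM}x}{\cos(2\gamma t)}\Big), $$ and let $u=\mathcal{R}(e^{it}Q)$. Put $T_*=\frac{\pi}{4\gamma}$ and $\mathscr{H}^1=\{f\in L^2:\nabla f,\ xf\in L^2\}$ with norm $\|\nabla f\|_2+\|xf\|_2+\|f\|_2$. Then: 1. For $0\le t<T_*$ and $x\in\mathbb{R}^n$, $$ u(t,x)=\frac{1}{\cos^{n/2}(2\gamma t)}\,e^{-i\frac{\gamma}{2}|x|^2\tan(2\gamma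 t)}\,e^{i\frac{\tan(2\gamma t)}{2\gamma}}\,Q\Big(\frac{e^{tM}x}{\cos(2\gamma t)}\Big), $$ and $u(0,\cdot)=Q$. 2. $u\in C([0,T_*);\mathscr{H}^1)$, and $u$ is a classical solution of (1) on $[0,T_*)\times\mathbb{R}^n$: $u(t,\cdot)$ is $C^2$ in $x$, $u_t$ exists and is continuous in $(t,x)$ (one-sided derivative at $t=0$), and (1) holds at every point. 3. $\|u(t)\|_2=\|Q\|_2$ for $0\le t<T_*$. 4. $u$ blows up at time $T_*$: $\|\nabla u(t)\|_2\to\infty$ as $t\uparrow T_*$, with $$ \|\nabla u(t)\|_2\approx\frac{\|\nabla Q\|_2}{\frac{\pi}{2}-2\gamma t}\qquad (t\uparrow T_*), $$ where $\approx$ means that the quotient of the two sides tends to $1$. 5. $u$ is not covered by the characterization of the minimal mass blowup solutions of (1) with blowup time $T<T_*$: for all $T\in(0,T_*)$, $\kappa>0$, $\theta\in\mathbb{R}$, $x_1\in\mathbb{R}^n$ and every $t\in[0,T)$, the function $u(t,\cdot)$ is not almost everywhere equal to $$ x\mapsto e^{i\theta}\,(\kappa\, a(t))^{n/2}\,e^{-i\frac{\gamma}{2}|x|^2\cot(2\gamma(T-t))}\,e^{i\kappa^2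 a(t)\cos(2\gamma t)}\,Q\big(\kappa\, a(t)\,e^{tM}x-x_1\big),\qquad a(t)=\frac{2\gamma\cos(2\gamma T)}{\sin(2\gamma(T-t))}. $$ -/

import Mathlib

open MeasureTheory Filter Topology Set Asymptotics
open scoped ENNReal ContDiff Laplacian

noncomputable section

namespace RotNLS

/-- The Euclidean space `ℝⁿ`. -/
abbrev Space (n : ℕ) : Type := EuclideanSpace ℝ (Fin n)

/-- The linear map `x ↦ A x` of `ℝⁿ` given by a real matrix. -/
def mulMat {n : ℕ} (A : Matrix (Fin n) (Fin n) ℝ) (x : Space n) : Space n :=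
  Matrix.toEuclideanLin A x

/-- `g` is a weak (distributional) gradient of `f : ℝⁿ → ℂ`. -/
def HasWeakGrad {n : ℕ} (f : Space n → ℂ) (g : Space n → EuclideanSpace ℂ (Fin n)) : Prop :=
  LocallyIntegrable f volume ∧ LocallyIntegrable g volume ∧
    ∀ φ : Space n → ℝ, ContDiff ℝ ∞ φ → HasCompactSupport φ → ∀ j : Fin n,
      ∫ x, (fderiv ℝ φ x (EuclideanSpace.single j 1)) • f x = - ∫ x, φ x • g x j

/-- The norm `‖∇f‖₂ ∈ [0, ∞]`, with `∇f` the weak gradient; it is `∞` when `f` has no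
locally integrable weak gradient.  The weak gradient is unique almost everywhere, so the infimum
is over one value at most (`gradNorm_eq`). -/
def gradNorm {n : ℕ} (f : Space n → ℂ) : ℝ≥0∞ :=
  ⨅ (g : Space n → EuclideanSpace ℂ (Fin n)) (_ : HasWeakGrad f g), eLpNorm g 2 volume

theorem HasWeakGrad.ae_eq {n : ℕ} {f : Space n → ℂ} {g h : Space n → EuclideanSpace ℂ (Fin n)}
    (hg : HasWeakGrad f g) (hh : HasWeakGrad f h) : g =ᵐ[volume] h := by
  have key : ∀ j : Fin n, (fun x => g x j) =ᵐ[volume] fun x => h x j := by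
    intro j
    have hgj : LocallyIntegrable (fun x => g x j) volume := fun x => by
      obtain ⟨s, hs, hi⟩ := hg.2.1 x
      exact ⟨s, hs, (EuclideanSpace.proj (𝕜 := ℂ) j).integrable_comp hi⟩
    have hhj : LocallyIntegrable (fun x => h x j) volume := fun x => by
      obtain ⟨s, hs, hi⟩ := hh.2.1 x
      exact ⟨s, hs, (EuclideanSpace.proj (𝕜 := ℂ) j).integrable_comp hi⟩
    refine ae_eq_of_integral_contDiff_smul_eq hgj hhj ?_
    intro φ hφ hc
    have h1 := hg.2.2 φ hφ hc j
    have h2 := hh.2.2 φ hφ hc j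
    exact neg_injective (h1.symm.trans h2)
  filter_upwards [ae_all_iff.2 key] with x hx
  ext j
  exact hx j

theorem gradNorm_eq {n : ℕ} {f : Space n → ℂ} {g : Space n → EuclideanSpace ℂ (Fin n)}
    (hg : HasWeakGrad f g) : gradNorm f = eLpNorm g 2 volume := by
  refine le_antisymm (iInf₂_le g hg) (le_iInf₂ fun h hh => ?_)
  exact (eLpNorm_congr_ae (hg.ae_eq hh)).le

/-- `f ∈ H¹(ℝⁿ)`. -/
def MemSobolev {n : ℕ} (f : Space n → ℂ) : Prop :=
  MemLp f 2 volume ∧ gradNorm f < ⊤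

/-- `f ∈ ℋ¹(ℝⁿ)`, that is, `f`, `∇f` and `x f` are in `L²`. -/
def MemWeightedSobolev {n : ℕ} (f : Space n → ℂ) : Prop :=
  MemLp f 2 volume ∧ gradNorm f < ⊤ ∧ MemLp (fun x => ‖x‖ • f x) 2 volume

/-- The norm `‖∇f‖₂ + ‖x f‖₂ + ‖f‖₂` of `ℋ¹(ℝⁿ)`. -/
def weightedNorm {n : ℕ} (f : Space n → ℂ) : ℝ≥0∞ :=
  gradNorm f + eLpNorm (fun x => ‖x‖ • f x) 2 volume + eLpNorm f 2 volume

/-- `u ∈ C([0, T); ℋ¹(ℝⁿ))`. -/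
def ContinuousInWeightedSobolev {n : ℕ} (T : ℝ) (u : ℝ → Space n → ℂ) : Prop :=
  (∀ t ∈ Ico 0 T, MemWeightedSobolev (u t)) ∧
    ∀ t ∈ Ico 0 T, Tendsto (fun s => weightedNorm (u s - u t)) (𝓝[Ico 0 T] t) (𝓝 0)

/-- `Q` is a ground state: a positive radial function in `H¹(ℝⁿ)`, of class `C²`, with
`-Q = -ΔQ - Q^(1 + 4/n)`. -/
structure IsGroundState {n : ℕ} (Q : Space n → ℝ) : Prop where
  contDiff : ContDiff ℝ 2 Q
  memSobolev : MemSobolev fun x => (Q x : ℂ)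
  pos : ∀ x, 0 < Q x
  radial : ∀ x y, ‖x‖ = ‖y‖ → Q x = Q y
  equation : ∀ x, -Q x = -(Δ Q) x - Q x ^ (1 + 4 / (n : ℝ))

/-- `u ∈ C([0, T); ℋ¹)` is a classical solution on `[0, T) × ℝⁿ` of the mass-critical rotational NLS
`i u_t = -Δu + γ²|x|² u - |u|^(4/n) u + i (M x) · ∇u`: it is `C²` in `x`, has a time derivative
that is continuous in `(t, x)` (one-sided at `t = 0`), and satisfies the equation at every point.
-/
structure IsSolution {n : ℕ} (γ : ℝ) (M : Matrix (Fin n) (Fin n) ℝ) (T : ℝ)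
    (u : ℝ → Space n → ℂ) : Prop where
  continuous : ContinuousInWeightedSobolev T u
  contDiff : ∀ t ∈ Ico 0 T, ContDiff ℝ 2 (u t)
  equation : ∃ ut : ℝ → Space n → ℂ,
    ContinuousOn (fun p : ℝ × Space n => ut p.1 p.2) (Ico 0 T ×ˢ univ) ∧
    ∀ t ∈ Ico 0 T, ∀ x : Space n,
      HasDerivWithinAt (fun s => u s x) (ut t x) (Ico 0 T) t ∧
      Complex.I * ut t x =
        -(Δ (u t)) x + ((γ ^ 2 * ‖x‖ ^ 2 : ℝ) : ℂ) * u t x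
          - ((‖u t x‖ ^ (4 / (n : ℝ)) : ℝ) : ℂ) * u t x
          + Complex.I * fderiv ℝ (u t) x (mulMat M x)

/-- The `ℛ`-transform
`ℛφ(t, x) = cos(2γt)^(-n/2) exp(-i (γ/2) |x|² tan(2γt)) φ(tan(2γt)/(2γ), e^{tM} x / cos(2γt))`. -/
def rTransform {n : ℕ} (γ : ℝ) (M : Matrix (Fin n) (Fin n) ℝ) (φ : ℝ → Space n → ℂ)
    (t : ℝ) (x : Space n) : ℂ :=
  ((1 / Real.cos (2 * γ * t) ^ ((n : ℝ) / 2) : ℝ) : ℂ)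
    * Complex.exp (-Complex.I * ((γ / 2 * ‖x‖ ^ 2 * Real.tan (2 * γ * t) : ℝ) : ℂ))
    * φ (Real.tan (2 * γ * t) / (2 * γ))
        ((Real.cos (2 * γ * t))⁻¹ • mulMat (NormedSpace.exp (t • M)) x)

/-- The solitary wave `e^{it} Q(x)`. -/
def solitaryWave {n : ℕ} (Q : Space n → ℝ) (t : ℝ) (x : Space n) : ℂ :=
  Complex.exp (Complex.I * (t : ℂ)) * (Q x : ℂ)

/-- The minimal mass blowup profiles with blowup time `T < π/(4γ)`.  With
`a(t) = 2γ cos(2γT) / sin(2γ(T - t))`, the function is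
`e^{iθ} (κ a(t))^(n/2) exp(-i (γ/2) |x|² cot(2γ(T - t))) exp(i κ² a(t) cos(2γt))
  Q(κ a(t) e^{tM} x - x₁)`.
The parameters `κ > 0` and `θ` come from the scaling and phase invariances. -/
def minimalMassProfile {n : ℕ} (γ : ℝ) (M : Matrix (Fin n) (Fin n) ℝ) (Q : Space n → ℝ)
    (T κ θ : ℝ) (x₁ : Space n) (t : ℝ) (x : Space n) : ℂ :=
  let a : ℝ := 2 * γ * Real.cos (2 * γ * T) / Real.sin (2 * γ * (T - t))
  Complex.exp (Complex.I * (θ : ℂ))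
    * (((κ * a) ^ ((n : ℝ) / 2) : ℝ) : ℂ)
    * Complex.exp (-Complex.I * ((γ / 2 * ‖x‖ ^ 2 * Real.cot (2 * γ * (T - t)) : ℝ) : ℂ))
    * Complex.exp (Complex.I * ((κ ^ 2 * a * Real.cos (2 * γ * t) : ℝ) : ℂ))
    * (Q ((κ * a) • mulMat (NormedSpace.exp (t • M)) x - x₁) : ℂ)

end RotNLS

end

/-!
The solution `u` is the lens transform of the solitary wave `e^{it} Q`. As `M` is skew-symmetric,
`e^{tM}` is an isometry, so it does not change the radial function `Q`, and
`u(t, x) = w(t) exp(-i b(t) |x|²) Q(c(t) x)` with `c = 1 / cos(2γt)`, `b = (γ / 2) tan(2γt)` and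
`|w|² = c ^ n` (`rTransform_solitaryWave_eq_lensWave`). Moreover `u(t, ·)` is radial, so that
`(M x) · ∇u = 0` because `M x` is orthogonal to `x`, and the equation reduces to the one with a
harmonic potential only, which is a computation (`laplacian_chirp`, `hasDerivAt_lensWave`,
`lensWave_equation`).

By scaling, `‖u(t)‖₂ = ‖Q‖₂`, `‖x u(t)‖₂ = ‖x Q‖₂ / c` and
`‖∇u(t)‖₂² = c² ‖∇Q‖₂² + γ² sin²(2γt) ‖x Q‖₂²` (`gradNorm_lensWave`). This gives the conservation of
mass and the blowup rate, as `c ~ 1 / (π/2 - 2γt)` and `∇Q ≠ 0`. It also gives the continuity in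
`ℋ¹`: everything converges pointwise in `x` as `s → t`, and the `L²` norms converge, so there is
convergence in `L²` (`tendsto_eLpNorm_two_sub_of_tendsto`).

What these formulas need is that `‖x Q‖₂` is finite (`IsGroundState.integrable_norm_sq_mul_sq`). In
polar coordinates `Q` is a function `q` of `r` with `q'' + ((n - 1) / r) q' = q - q ^ (1 + 4 / n)`.
As `Q ∈ H¹`, `q` tends to `0` (`tendsto_zero_of_integrableOn_sq`), so the right-hand side is
eventually at least `q / 2`; then `q` is nonincreasing far out, and a monotone quantity bounds
`∫ r ^ (n + 1) q` (`exists_integrableOn_Ioi_pow_mul`).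

Finally, two functions of the form constant × `exp(-i b |x|²)` × positive can agree only if their
`b` do (`quadraticPhase_unique`). For `u` and a minimal mass profile with blowup time `T` this says
`tan(2γt) = cot(2γ(T - t))`, that is, `cos(2γT) = 0`, which fails for `T < π / (4γ)`.
-/

noncomputable section

namespace RotNLS

/-! ### Quadratic integrals and convergence in `L²` -/

theorem eLpNorm_two_eq_ofReal_sqrt {α E : Type*} [MeasurableSpace α] {μ : Measure α}
    [NormedAddCommGroup E] {f : α → E} (hf : MemLp f 2 μ) :
    eLpNorm f 2 μ = ENNReal.ofReal (√(∫ x, ‖f x‖ ^ 2 ∂μ)) := by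
  rw [hf.eLpNorm_eq_integral_rpow_norm two_ne_zero ENNReal.ofNat_ne_top, Real.sqrt_eq_rpow]
  norm_num

theorem eLpNorm_two_sq {α E : Type*} [MeasurableSpace α] {μ : Measure α}
    [NormedAddCommGroup E] (f : α → E) :
    eLpNorm f 2 μ ^ 2 = ∫⁻ x, ‖f x‖ₑ ^ 2 ∂μ := by
  have := eLpNorm_nnreal_pow_eq_lintegral (f := f) (μ := μ) (p := 2) two_ne_zero
  norm_num at this
  exact_mod_cast this

/-- Pointwise convergence together with convergence of the `L²` norms gives convergence in `L²`
(Riesz–Scheffé): Fatou's lemma is applied to `2 |fᵢ|² + 2 |g|² - |fᵢ - g|² ≥ 0`. -/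
theorem tendsto_eLpNorm_two_sub_of_tendsto {ι α E : Type*} [MeasurableSpace α] {μ : Measure α}
    [NormedAddCommGroup E] {l : Filter ι} [l.IsCountablyGenerated] {f : ι → α → E} {g : α → E}
    (hf : ∀ i, AEStronglyMeasurable (f i) μ) (hg : MemLp g 2 μ)
    (hfg : ∀ x, Tendsto (fun i => f i x) l (𝓝 (g x)))
    (hnorm : Tendsto (fun i => eLpNorm (f i) 2 μ) l (𝓝 (eLpNorm g 2 μ))) :
    Tendsto (fun i => eLpNorm (f i - g) 2 μ) l (𝓝 0) := by
  rcases l.eq_or_neBot with rfl | hl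
  · exact tendsto_bot
  set φ : ι → α → ℝ≥0∞ := fun i x => 2 * ‖f i x‖ₑ ^ 2 + 2 * ‖g x‖ₑ ^ 2 - ‖f i x - g x‖ₑ ^ 2 with hφ
  have hle : ∀ i x, ‖f i x - g x‖ₑ ^ 2 ≤ 2 * ‖f i x‖ₑ ^ 2 + 2 * ‖g x‖ₑ ^ 2 := by
    intro i x
    have h : ‖f i x - g x‖₊ ^ 2 ≤ 2 * ‖f i x‖₊ ^ 2 + 2 * ‖g x‖₊ ^ 2 := by
      rw [← NNReal.coe_le_coe]
      push_cast
      nlinarith [norm_sub_le (f i x) (g x), norm_nonneg (f i x - g x),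
        sq_nonneg (‖f i x‖ - ‖g x‖), norm_nonneg (f i x), norm_nonneg (g x)]
    simp only [enorm_eq_nnnorm]
    exact_mod_cast h
  set G := ∫⁻ x, ‖g x‖ₑ ^ 2 ∂μ with hG
  have hGtop : G ≠ ⊤ := by
    rw [hG, ← eLpNorm_two_sq]
    exact ENNReal.pow_ne_top hg.2.ne
  have hnorm' : Tendsto (fun i => ∫⁻ x, ‖f i x‖ₑ ^ 2 ∂μ) l (𝓝 G) := by
    simp only [hG, ← eLpNorm_two_sq]
    exact ENNReal.Tendsto.pow hnorm
  have hsum : ∀ i, ∫⁻ x, φ i x ∂μ + ∫⁻ x, ‖f i x - g x‖ₑ ^ 2 ∂μ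
      = 2 * ∫⁻ x, ‖f i x‖ₑ ^ 2 ∂μ + 2 * G := by
    intro i
    have hi := hf i
    have hm : AEMeasurable (fun x => ‖f i x - g x‖ₑ ^ 2) μ := (hi.sub hg.1).enorm.pow_const 2
    rw [← lintegral_add_right' _ hm]
    simp only [hφ, tsub_add_cancel_of_le (hle i _)]
    rw [lintegral_add_left' ((hi.enorm.pow_const 2).const_mul 2),
      lintegral_const_mul'' _ (hi.enorm.pow_const 2),
      lintegral_const_mul'' _ (hg.1.enorm.pow_const 2)]
  have hlim : Tendsto (fun i => 2 * ∫⁻ x, ‖f i x‖ₑ ^ 2 ∂μ + 2 * G) l (𝓝 (2 * G + 2 * G)) :=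
    (ENNReal.Tendsto.const_mul hnorm' (Or.inr (by simp))).add tendsto_const_nhds
  have hφx : ∀ x, Tendsto (fun i => φ i x) l (𝓝 (2 * ‖g x‖ₑ ^ 2 + 2 * ‖g x‖ₑ ^ 2)) := by
    intro x
    have h0 : 2 * ‖g x‖ₑ ^ 2 + 2 * ‖g x‖ₑ ^ 2
        = 2 * ‖g x‖ₑ ^ 2 + 2 * ‖g x‖ₑ ^ 2 - ‖g x - g x‖ₑ ^ 2 := by simp
    rw [h0]
    refine ENNReal.Tendsto.sub ?_ ?_ (Or.inr (by simp))
    · exact (ENNReal.Tendsto.const_mul (ENNReal.Tendsto.pow (hfg x).enorm)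
        (Or.inr (by simp))).add tendsto_const_nhds
    · exact ENNReal.Tendsto.pow ((hfg x).sub tendsto_const_nhds).enorm
  have hfatou : 2 * G + 2 * G ≤ liminf (fun i => ∫⁻ x, φ i x ∂μ) l := by
    calc 2 * G + 2 * G = ∫⁻ x, liminf (fun i => φ i x) l ∂μ := by
          simp only [(hφx _).liminf_eq]
          rw [lintegral_add_left' ((hg.1.enorm.pow_const 2).const_mul 2),
            lintegral_const_mul'' _ (hg.1.enorm.pow_const 2)]
      _ ≤ _ := lintegral_liminf_le' fun i => (((hf i).enorm.pow_const 2).const_mul 2).add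
              ((hg.1.enorm.pow_const 2).const_mul 2) |>.sub
                (((hf i).sub hg.1).enorm.pow_const 2)
  have hφlim : Tendsto (fun i => ∫⁻ x, φ i x ∂μ) l (𝓝 (2 * G + 2 * G)) := by
    refine tendsto_of_le_liminf_of_limsup_le hfatou ?_
    rw [← hlim.limsup_eq]
    exact limsup_le_limsup (.of_forall fun i => le_self_add.trans_eq (hsum i))
  have h4 : 2 * G + 2 * G ≠ ⊤ := by finiteness
  have hd : Tendsto (fun i => ∫⁻ x, ‖f i x - g x‖ₑ ^ 2 ∂μ) l (𝓝 0) := by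
    have := ENNReal.Tendsto.sub hlim hφlim (Or.inl h4)
    rw [tsub_self] at this
    refine this.congr' ?_
    filter_upwards [hφlim.eventually (gt_mem_nhds h4.lt_top)] with i hi'
    rw [← hsum i, ENNReal.add_sub_cancel_left hi'.ne]
  have hsqrt := hd.ennrpow_const (1 / 2 : ℝ)
  rw [ENNReal.zero_rpow_of_pos (by norm_num)] at hsqrt
  refine hsqrt.congr fun i => ?_
  have h1 : ∫⁻ x, ‖f i x - g x‖ₑ ^ 2 ∂μ = eLpNorm (f i - g) 2 μ ^ 2 := (eLpNorm_two_sq _).symm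
  rw [h1, ← ENNReal.rpow_natCast, ← ENNReal.rpow_mul]
  norm_num

/-! ### Classical gradients and Laplacians -/

variable {n : ℕ}

/-- The classical gradient `(∂₁f, …, ∂ₙf)` of a complex-valued function on `ℝⁿ`. -/
def classicalGrad (f : Space n → ℂ) (x : Space n) : EuclideanSpace ℂ (Fin n) :=
  WithLp.toLp 2 fun j => fderiv ℝ f x (EuclideanSpace.single j 1)

theorem continuous_classicalGrad {f : Space n → ℂ} (hf : ContDiff ℝ 1 f) :
    Continuous (classicalGrad f) := by
  refine (PiLp.continuous_toLp 2 _).comp (continuous_pi fun j => ?_)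
  exact (hf.continuous_fderiv one_ne_zero).clm_apply continuous_const

theorem classicalGrad_sub {f g : Space n → ℂ} (hf : ContDiff ℝ 1 f) (hg : ContDiff ℝ 1 g) :
    classicalGrad (f - g) = classicalGrad f - classicalGrad g := by
  ext x j
  simp [classicalGrad, fderiv_sub (hf.differentiable one_ne_zero x)
    (hg.differentiable one_ne_zero x)]

/-- Integration by parts against test functions. -/
theorem hasWeakGrad_classicalGrad {f : Space n → ℂ} (hf : ContDiff ℝ 1 f) :
    HasWeakGrad f (classicalGrad f) := by
  refine ⟨hf.continuous.locallyIntegrable, (continuous_classicalGrad hf).locallyIntegrable, ?_⟩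
  intro φ hφ hc j
  have hφ1 : ContDiff ℝ 1 φ := hφ.of_le (by exact_mod_cast le_top)
  have hdφ : Continuous fun x => fderiv ℝ φ x (EuclideanSpace.single j 1) :=
    (hφ1.continuous_fderiv one_ne_zero).clm_apply continuous_const
  have hdf : Continuous fun x => fderiv ℝ f x (EuclideanSpace.single j 1) :=
    (hf.continuous_fderiv one_ne_zero).clm_apply continuous_const
  have key := integral_smul_fderiv_eq_neg_fderiv_smul_of_integrable (μ := volume)
    (f := φ) (g := f) (v := EuclideanSpace.single j 1)
    ((hdφ.smul hf.continuous).integrable_of_hasCompactSupport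
      ((hc.fderiv_apply (𝕜 := ℝ) (EuclideanSpace.single j 1)).smul_right))
    ((hφ.continuous.smul hdf).integrable_of_hasCompactSupport hc.smul_right)
    ((hφ.continuous.smul hf.continuous).integrable_of_hasCompactSupport hc.smul_right)
    (fun x _ => hφ1.differentiable one_ne_zero x) (fun x _ => hf.differentiable one_ne_zero x)
  rw [eq_neg_iff_add_eq_zero, add_comm, ← eq_neg_iff_add_eq_zero]
  exact key

theorem gradNorm_eq_eLpNorm_classicalGrad {f : Space n → ℂ} (hf : ContDiff ℝ 1 f) :
    gradNorm f = eLpNorm (classicalGrad f) 2 volume :=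
  gradNorm_eq (hasWeakGrad_classicalGrad hf)

/-- The Laplacian of a `C²` function from its iterated partial derivatives. -/
theorem laplacian_eq_sum_of_hasLineDerivAt {F : Type*} [NormedAddCommGroup F] [NormedSpace ℝ F]
    {f : Space n → F} (hf : ContDiff ℝ 2 f) {f₁ : Fin n → Space n → F} {f₂ : Fin n → F}
    {x : Space n} (h₁ : ∀ j y, HasLineDerivAt ℝ f (f₁ j y) y (EuclideanSpace.single j 1))
    (h₂ : ∀ j, HasLineDerivAt ℝ (f₁ j) (f₂ j) x (EuclideanSpace.single j 1)) :
    (Δ f) x = ∑ j, f₂ j := by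
  rw [InnerProductSpace.laplacian_eq_iteratedFDeriv_orthonormalBasis f
    (EuclideanSpace.basisFun (Fin n) ℝ)]
  refine Finset.sum_congr rfl fun j _ => ?_
  have hf1 : ContDiff ℝ 1 (fderiv ℝ f) := hf.fderiv_right (by norm_num)
  have e1 : f₁ j = fun y => fderiv ℝ f y (EuclideanSpace.single j 1) := by
    ext y
    exact (h₁ j y).lineDeriv.symm.trans
      ((hf.differentiable two_ne_zero y).hasFDerivAt.hasLineDerivAt _).lineDeriv
  have e2 : HasFDerivAt (f₁ j)
      ((fderiv ℝ (fderiv ℝ f) x).flip (EuclideanSpace.single j 1)) x := by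
    rw [e1]
    simpa using (hf1.differentiable one_ne_zero x).hasFDerivAt.clm_apply
      (hasFDerivAt_const (EuclideanSpace.single j (1 : ℝ)) x)
  rw [iteratedFDeriv_two_apply, (h₂ j).lineDeriv.symm, (e2.hasLineDerivAt _).lineDeriv]
  simp

/-! ### Decay of positive solutions of the radial equation -/

/-- Strauss' argument: `r ^ d q²` is integrable together with its derivative, hence tends to `0`,
and it dominates `q²` for `r ≥ 1`. -/
theorem tendsto_zero_of_integrableOn_sq {d : ℕ} {q q' : ℝ → ℝ}
    (hq : ∀ r, HasDerivAt q (q' r) r) (hq' : Continuous q')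
    (h0 : IntegrableOn (fun r => r ^ d * q r ^ 2) (Ioi 1))
    (h1 : IntegrableOn (fun r => r ^ d * q' r ^ 2) (Ioi 1)) :
    Tendsto q atTop (𝓝 0) := by
  have hqc : Continuous q := continuous_iff_continuousAt.2 fun r => (hq r).continuousAt
  have hder : ∀ r ∈ Ioi (1 : ℝ), HasDerivAt (fun r => r ^ d * q r ^ 2)
      (d * r ^ (d - 1) * q r ^ 2 + r ^ d * (2 * q r * q' r)) r := by
    intro r _
    convert! (hasDerivAt_pow d r).mul ((hq r).pow 2) using 2
    norm_num
  have hint : IntegrableOn (fun r => d * r ^ (d - 1) * q r ^ 2 + r ^ d * (2 * q r * q' r))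
      (Ioi 1) := by
    refine Integrable.mono' ((h0.const_mul (d + 1)).add h1) ?_ ?_
    · exact (by fun_prop : Continuous fun r : ℝ =>
        d * r ^ (d - 1) * q r ^ 2 + r ^ d * (2 * q r * q' r)).aestronglyMeasurable
    · filter_upwards [ae_restrict_mem measurableSet_Ioi] with r hr
      have hr1 : (1 : ℝ) ≤ r := le_of_lt hr
      have hp : r ^ (d - 1) ≤ r ^ d := pow_le_pow_right₀ hr1 (Nat.sub_le d 1)
      have hp0 : 0 ≤ r ^ d := by positivity
      have hp1 : 0 ≤ r ^ (d - 1) := by positivity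
      have ha : (d : ℝ) * r ^ (d - 1) * q r ^ 2 ≤ d * (r ^ d * q r ^ 2) := by
        rw [mul_assoc]
        gcongr
      have ha0 : 0 ≤ (d : ℝ) * r ^ (d - 1) * q r ^ 2 := by positivity
      have hb : |r ^ d * (2 * q r * q' r)| ≤ r ^ d * q r ^ 2 + r ^ d * q' r ^ 2 := by
        rw [abs_mul, abs_of_nonneg hp0, ← mul_add]
        gcongr
        exact abs_le.2 ⟨by nlinarith [sq_nonneg (q r + q' r)],
          by nlinarith [sq_nonneg (q r - q' r)]⟩
      rw [Real.norm_eq_abs]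
      simp only [Pi.add_apply]
      calc _ ≤ |(d : ℝ) * r ^ (d - 1) * q r ^ 2| + |r ^ d * (2 * q r * q' r)| := abs_add_le _ _
        _ ≤ d * (r ^ d * q r ^ 2) + (r ^ d * q r ^ 2 + r ^ d * q' r ^ 2) := by
          rw [abs_of_nonneg ha0]
          exact add_le_add ha hb
        _ = _ := by ring
  have hG : Tendsto (fun r => r ^ d * q r ^ 2) atTop (𝓝 0) :=
    tendsto_zero_of_hasDerivAt_of_integrableOn_Ioi hder hint h0
  have hsq : Tendsto (fun r => q r ^ 2) atTop (𝓝 0) := by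
    refine squeeze_zero' (.of_forall fun r => sq_nonneg _) ?_ hG
    filter_upwards [eventually_ge_atTop 1] with r hr
    exact le_mul_of_one_le_left (sq_nonneg _) (one_le_pow₀ hr)
  rw [tendsto_zero_iff_abs_tendsto_zero]
  have := (Real.continuous_sqrt.tendsto 0).comp hsq
  simpa [Function.comp_def, Real.sqrt_sq_eq_abs] using this

/-- A positive solution of `q'' + (d / r) q' ≥ q / 2` that vanishes at infinity is eventually
nonincreasing: otherwise the nondecreasing function `r ^ d q'` becomes positive, and `q` increases
from there on. -/
theorem deriv_nonpos_of_radial_supersolution {d : ℕ} {q q' q'' : ℝ → ℝ} {R : ℝ} (hR : 0 < R)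
    (hq : ∀ r, HasDerivAt q (q' r) r) (hq' : ∀ r, HasDerivAt q' (q'' r) r)
    (hpos : ∀ r, 0 < q r) (hlim : Tendsto q atTop (𝓝 0))
    (hode : ∀ r, R ≤ r → q r / 2 ≤ q'' r + d / r * q' r) {r : ℝ} (hr : R ≤ r) : q' r ≤ 0 := by
  have hder : ∀ s : ℝ, HasDerivAt (fun s => s ^ d * q' s)
      (d * s ^ (d - 1) * q' s + s ^ d * q'' s) s :=
    fun s => (hasDerivAt_pow d s).mul (hq' s)
  have hmono : MonotoneOn (fun s => s ^ d * q' s) (Ici R) := by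
    refine monotoneOn_of_deriv_nonneg (convex_Ici R)
      (fun s _ => (hder s).continuousAt.continuousWithinAt)
      (fun s _ => (hder s).differentiableAt.differentiableWithinAt) fun s hs => ?_
    rw [interior_Ici] at hs
    have hs0 : 0 < s := hR.trans hs
    rw [(hder s).deriv]
    have h2 := hode s (le_of_lt hs)
    have h1 : (d : ℝ) * s ^ (d - 1) * q' s + s ^ d * q'' s = s ^ d * (q'' s + d / s * q' s) := by
      rcases d with _ | d
      · simp
      · rw [pow_succ]
        simp only [Nat.add_sub_cancel]
        field_simp
        ring
    rw [h1]
    have := hpos s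
    exact mul_nonneg (by positivity) (by linarith)
  by_contra! hc
  have hr0 : 0 < r := hR.trans_le hr
  have hq'pos : ∀ s, r ≤ s → 0 < q' s := by
    intro s hs
    have h1 : r ^ d * q' r ≤ s ^ d * q' s := hmono hr (hr.trans hs) hs
    have h2 : 0 < s ^ d := pow_pos (hr0.trans_le hs) d
    have h3 : 0 < r ^ d * q' r := by positivity
    by_contra! h4
    nlinarith
  have hqmono : MonotoneOn q (Ici r) := by
    refine monotoneOn_of_deriv_nonneg (convex_Ici r)
      (fun s _ => (hq s).continuousAt.continuousWithinAt)
      (fun s _ => (hq s).differentiableAt.differentiableWithinAt) fun s hs => ?_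
    rw [interior_Ici] at hs
    rw [(hq s).deriv]
    exact (hq'pos s (le_of_lt hs)).le
  have : q r ≤ 0 := by
    refine ge_of_tendsto hlim ?_
    filter_upwards [eventually_ge_atTop r] with s hs
    exact hqmono self_mem_Ici hs hs
  exact absurd (hpos r) this.not_gt

/-- A positive solution of `q'' + (d / r) q' ≥ q / 2` that vanishes at infinity has a finite moment
`∫ r ^ (d + 2) q`: the nonpositive function `F = r ^ (d + 2) q' - 2 r ^ (d + 1) q` satisfies
`F' ≥ r ^ (d + 2) q / 4` for large `r`. -/
theorem exists_integrableOn_Ioi_pow_mul {d : ℕ} {q q' q'' : ℝ → ℝ} {R : ℝ} (hR : 0 < R)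
    (hq : ∀ r, HasDerivAt q (q' r) r) (hq' : ∀ r, HasDerivAt q' (q'' r) r)
    (hpos : ∀ r, 0 < q r) (hlim : Tendsto q atTop (𝓝 0))
    (hode : ∀ r, R ≤ r → q r / 2 ≤ q'' r + d / r * q' r) :
    ∃ R₁, 0 < R₁ ∧ IntegrableOn (fun r => r ^ (d + 2) * q r) (Ioi R₁) := by
  have hqc : Continuous q := continuous_iff_continuousAt.2 fun r => (hq r).continuousAt
  set R₁ := max R (8 * (d + 1))
  have hRR : R ≤ R₁ := le_max_left _ _
  have hR1 : 0 < R₁ := hR.trans_le hRR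
  refine ⟨R₁, hR1, ?_⟩
  set F : ℝ → ℝ := fun r => r ^ (d + 2) * q' r - 2 * (r ^ (d + 1) * q r) with hF
  have hder : ∀ r, HasDerivAt F
      ((d + 2 : ℕ) * r ^ (d + 1) * q' r + r ^ (d + 2) * q'' r
        - 2 * ((d + 1 : ℕ) * r ^ d * q r + r ^ (d + 1) * q' r)) r := fun r =>
    ((hasDerivAt_pow (d + 2) r).mul (hq' r)).sub
      (((hasDerivAt_pow (d + 1) r).mul (hq r)).const_mul 2)
  have hbound : ∀ r, R₁ ≤ r → r ^ (d + 2) * q r / 4 ≤ (d + 2 : ℕ) * r ^ (d + 1) * q' r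
      + r ^ (d + 2) * q'' r - 2 * ((d + 1 : ℕ) * r ^ d * q r + r ^ (d + 1) * q' r) := by
    intro r hr
    have hr0 : 0 < r := hR1.trans_le hr
    have h1 := hode r (hRR.trans hr)
    have h2 : ((d + 2 : ℕ) : ℝ) * r ^ (d + 1) * q' r + r ^ (d + 2) * q'' r
        - 2 * ((d + 1 : ℕ) * r ^ d * q r + r ^ (d + 1) * q' r)
        = r ^ (d + 2) * (q'' r + d / r * q' r) - 2 * (d + 1) * (r ^ d * q r) := by
      push_cast
      field_simp
      ring
    have h3 : r ^ (d + 2) * (q r / 2) ≤ r ^ (d + 2) * (q'' r + d / r * q' r) := by gcongr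
    have h8 : 8 * ((d : ℝ) + 1) ≤ r := (le_max_right _ _).trans hr
    have h9 : 8 * ((d : ℝ) + 1) ≤ r ^ 2 := by nlinarith [(Nat.cast_nonneg d : (0 : ℝ) ≤ d)]
    have h4 : 8 * ((d : ℝ) + 1) * (r ^ d * q r) ≤ r ^ 2 * (r ^ d * q r) := by
      have := hpos r
      gcongr
    have h5 : r ^ (d + 2) * q r = r ^ 2 * (r ^ d * q r) := by ring
    rw [h2]
    linarith
  have hFneg : ∀ r, R₁ ≤ r → F r ≤ 0 := by
    intro r hr
    have hr0 : 0 < r := hR1.trans_le hr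
    have h1 := deriv_nonpos_of_radial_supersolution hR hq hq' hpos hlim hode (hRR.trans hr)
    have h2 : r ^ (d + 2) * q' r ≤ 0 := mul_nonpos_of_nonneg_of_nonpos (by positivity) h1
    have h3 : 0 ≤ r ^ (d + 1) * q r := mul_nonneg (by positivity) (hpos r).le
    simp only [hF]
    linarith
  have hcont : Continuous fun r => r ^ (d + 2) * q r := by fun_prop
  refine integrableOn_Ioi_of_intervalIntegral_norm_bounded (4 * (-F R₁)) R₁
    (l := atTop) (b := id) (fun r => hcont.integrableOn_Ioc) tendsto_id ?_
  filter_upwards [eventually_ge_atTop R₁] with r hr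
  have h1 := intervalIntegral.integral_le_sub_of_hasDeriv_right_of_le (g := F) hr
    (fun s _ => (hder s).continuousAt.continuousWithinAt)
    (fun s _ => (hder s).hasDerivWithinAt) (φ := fun r => r ^ (d + 2) * q r / 4)
    ((hcont.div_const 4).integrableOn_Icc) (fun s hs => hbound s hs.1.le)
  rw [intervalIntegral.integral_div] at h1
  have h2 : ∫ s in R₁..id r, ‖s ^ (d + 2) * q s‖ = ∫ s in R₁..r, s ^ (d + 2) * q s := by
    refine intervalIntegral.integral_congr fun s hs => ?_
    rw [id, uIcc_of_le hr] at hs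
    exact Real.norm_of_nonneg (mul_nonneg (pow_nonneg (hR1.le.trans hs.1) _) (hpos s).le)
  rw [h2]
  linarith [hFneg r hr]

/-! ### Radial functions -/

/-- The restriction `r ↦ f (r eᵢ)` of a function on `ℝⁿ` to the `i`-th coordinate axis; for a radial
`f` this is its profile. -/
def axisProfile (f : Space n → ℝ) (i : Fin n) (r : ℝ) : ℝ :=
  f (r • EuclideanSpace.single i 1)

theorem axisProfile_norm {f : Space n → ℝ} (hrad : ∀ x y, ‖x‖ = ‖y‖ → f x = f y) (i : Fin n)
    (x : Space n) : axisProfile f i ‖x‖ = f x :=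
  hrad _ _ (by simp [norm_smul])

theorem contDiff_axisProfile {f : Space n → ℝ} (hf : ContDiff ℝ 2 f) (i : Fin n) :
    ContDiff ℝ 2 (axisProfile f i) :=
  hf.comp (contDiff_id.smul contDiff_const)

theorem deriv_axisProfile {f : Space n → ℝ} (hf : ContDiff ℝ 2 f) (i : Fin n) (r : ℝ) :
    deriv (axisProfile f i) r
      = fderiv ℝ f (r • EuclideanSpace.single i 1) (EuclideanSpace.single i 1) := by
  have h1 : HasDerivAt (fun r : ℝ => r • (EuclideanSpace.single i 1 : Space n))
      (EuclideanSpace.single i 1) r := by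
    simpa using (hasDerivAt_id r).smul_const (EuclideanSpace.single i 1 : Space n)
  exact ((hf.differentiable two_ne_zero _).hasFDerivAt.comp_hasDerivAt r h1).deriv

/-- The derivative of a radial function, `df_x(v) = q'(|x|) ⟨x, v⟩ / |x|` away from the origin. -/
theorem fderiv_radial {f : Space n → ℝ} (hf : ContDiff ℝ 2 f)
    (hrad : ∀ x y, ‖x‖ = ‖y‖ → f x = f y) (i : Fin n) {x : Space n} (hx : x ≠ 0) (v : Space n) :
    fderiv ℝ f x v = deriv (axisProfile f i) ‖x‖ * (inner ℝ x v / ‖x‖) := by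
  have hx2 : ‖x‖ ^ 2 ≠ 0 := by simpa using hx
  have h1 := (hasStrictFDerivAt_norm_sq x).hasFDerivAt.sqrt hx2
  have h2 : HasDerivAt (axisProfile f i) (deriv (axisProfile f i) ‖x‖) (√(‖x‖ ^ 2)) := by
    rw [Real.sqrt_sq (norm_nonneg x)]
    exact ((contDiff_axisProfile hf i).differentiable two_ne_zero _).hasDerivAt
  have h3 := h2.comp_hasFDerivAt x h1
  have h4 : (axisProfile f i ∘ fun y : Space n => √(‖y‖ ^ 2)) = f := by
    ext y
    simp [axisProfile_norm hrad i y]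
  rw [h4] at h3
  rw [h3.fderiv]
  have hx0 : ‖x‖ ≠ 0 := norm_ne_zero_iff.2 hx
  simp only [smul_apply, innerSL_apply_apply, smul_eq_mul, nsmul_eq_mul,
    Real.sqrt_sq (norm_nonneg x)]
  push_cast
  field_simp

/-- The Laplacian of a radial function in polar coordinates, at a point of the positive axis. -/
theorem laplacian_radial {f : Space n → ℝ} (hf : ContDiff ℝ 2 f)
    (hrad : ∀ x y, ‖x‖ = ‖y‖ → f x = f y) (i : Fin n) {r : ℝ} (hr : 0 < r) :
    (Δ f) (r • EuclideanSpace.single i 1) = deriv (deriv (axisProfile f i)) r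
      + (n - 1 : ℕ) / r * deriv (axisProfile f i) r := by
  have hq1 : ContDiff ℝ 1 (deriv (axisProfile f i)) :=
    (contDiff_succ_iff_deriv.1 (contDiff_axisProfile hf i)).2.2
  rw [laplacian_eq_sum_of_hasLineDerivAt hf
    (f₁ := fun j y => fderiv ℝ f y (EuclideanSpace.single j 1))
    (f₂ := fun j => if j = i then deriv (deriv (axisProfile f i)) r
      else deriv (axisProfile f i) r / r)
    (fun j y => (hf.differentiable two_ne_zero y).hasFDerivAt.hasLineDerivAt _)]
  · rw [Finset.sum_ite, Finset.sum_const, Finset.sum_const, Finset.filter_eq',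
      Finset.filter_ne']
    simp
    ring
  · intro j
    unfold HasLineDerivAt
    by_cases hj : j = i
    · subst hj
      have h1 : (fun t : ℝ => fderiv ℝ f (r • EuclideanSpace.single j 1
          + t • EuclideanSpace.single j 1) (EuclideanSpace.single j 1))
          = fun t => deriv (axisProfile f j) (r + t) := by
        ext t
        rw [deriv_axisProfile hf, add_smul]
      rw [h1, if_pos rfl]
      have h2 : HasDerivAt (deriv (axisProfile f j)) (deriv (deriv (axisProfile f j)) r)
          (r + 0) := by
        rw [add_zero]
        exact (hq1.differentiable one_ne_zero r).hasDerivAt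
      simpa using h2.comp_const_add r 0
    -- across the axis the first derivative is `t h(t)` with `h` continuous, of slope `h 0` at `0`
    · rw [if_neg hj]
      have hin : inner ℝ (EuclideanSpace.single i 1 : Space n) (EuclideanSpace.single j 1) = 0 := by
        simp [EuclideanSpace.inner_single_left, Ne.symm hj]
      have hn : ∀ t : ℝ, ‖(r • EuclideanSpace.single i 1 + t • EuclideanSpace.single j 1 : Space n)‖
          = √(r ^ 2 + t ^ 2) := by
        intro t
        rw [eq_comm, Real.sqrt_eq_iff_mul_self_eq (by positivity) (norm_nonneg _),
          norm_add_mul_self_real]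
        simp [norm_smul, inner_smul_left, inner_smul_right, hin]
        ring
      have hpos : ∀ t : ℝ, 0 < √(r ^ 2 + t ^ 2) := fun t => Real.sqrt_pos.2 (by positivity)
      set h : ℝ → ℝ := fun t =>
        deriv (axisProfile f i) (√(r ^ 2 + t ^ 2)) / √(r ^ 2 + t ^ 2) with hh
      have h1 : (fun t : ℝ => fderiv ℝ f (r • EuclideanSpace.single i 1
          + t • EuclideanSpace.single j 1) (EuclideanSpace.single j 1)) = fun t => t * h t := by
        ext t
        have hne : (r • EuclideanSpace.single i 1 + t • EuclideanSpace.single j 1 : Space n)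
            ≠ 0 := by
          rw [← norm_pos_iff, hn]
          exact hpos t
        rw [fderiv_radial hf hrad i hne, hn]
        simp [inner_add_left, inner_smul_left, hh, hin]
        ring
      have hcont : Continuous h :=
        (hq1.continuous.comp (by fun_prop)).div (by fun_prop) fun t => (hpos t).ne'
      have h0 : h 0 = deriv (axisProfile f i) r / r := by
        simp [hh, Real.sqrt_sq hr.le]
      rw [h1, ← h0, hasDerivAt_iff_tendsto_slope]
      refine ((hcont.tendsto 0).mono_left nhdsWithin_le_nhds).congr' ?_
      filter_upwards [self_mem_nhdsWithin] with t ht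
      have ht' : t ≠ 0 := ht
      simp [slope, ht']

/-- A radial function is stationary in the directions orthogonal to the position. -/
theorem fderiv_radial_eq_zero {F : Type*} [NormedAddCommGroup F] [NormedSpace ℝ F]
    {f : Space n → F} {x v : Space n} (hf : DifferentiableAt ℝ f x)
    (hrad : ∀ x y, ‖x‖ = ‖y‖ → f x = f y) (hxv : inner ℝ x v = 0) : fderiv ℝ f x v = 0 := by
  have h1 := hf.hasFDerivAt.hasLineDerivAt v
  have h2 := hf.hasFDerivAt.hasLineDerivAt (-v)
  have h3 : (fun t : ℝ => f (x + t • v)) = fun t => f (x + t • -v) := by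
    ext t
    refine hrad _ _ ?_
    rw [smul_neg, ← sub_eq_add_neg]
    refine (norm_add_eq_sqrt_iff_real_inner_eq_zero.2 ?_).trans
      (norm_sub_eq_sqrt_iff_real_inner_eq_zero.2 ?_).symm <;> simp [inner_smul_right, hxv]
  unfold HasLineDerivAt at h1 h2
  rw [h3] at h1
  have h4 := h1.unique h2
  rw [map_neg] at h4
  have h5 : (2 : ℝ) • fderiv ℝ f x v = 0 := by
    rw [two_smul]
    nth_rewrite 1 [h4]
    exact neg_add_cancel _
  exact (smul_eq_zero.1 h5).resolve_left two_ne_zero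

theorem apply_eq_sum_mul (L : Space n →L[ℝ] ℝ) (v : Space n) :
    L v = ∑ j, v j * L (EuclideanSpace.single j 1) := by
  conv_lhs => rw [← (EuclideanSpace.basisFun (Fin n) ℝ).sum_repr v]
  simp

theorem integrable_radial_iff {f : ℝ → ℝ} (hn : 1 ≤ n) :
    Integrable (fun x : Space n => f ‖x‖) volume
      ↔ IntegrableOn (fun r => r ^ (n - 1) * f r) (Ioi 0) := by
  have : Nonempty (Fin n) := ⟨⟨0, hn⟩⟩
  have := integrable_fun_norm_addHaar (volume : Measure (Space n)) (f := f)
  rw [finrank_euclideanSpace_fin] at this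
  simpa only [smul_eq_mul] using this

/-! ### The ground state -/

variable {Q : Space n → ℝ}

theorem IsGroundState.contDiff_ofReal (hQ : IsGroundState Q) : ContDiff ℝ 2 fun x => (Q x : ℂ) :=
  Complex.ofRealCLM.contDiff.comp hQ.contDiff

theorem IsGroundState.contDiff_one (hQ : IsGroundState Q) : ContDiff ℝ 1 Q :=
  hQ.contDiff.of_le one_le_two

theorem IsGroundState.differentiableAt (hQ : IsGroundState Q) (x : Space n) :
    DifferentiableAt ℝ Q x :=
  hQ.contDiff.differentiable two_ne_zero x

theorem fderiv_ofReal_comp {x : Space n} (hQ : DifferentiableAt ℝ Q x) (v : Space n) :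
    fderiv ℝ (fun y => (Q y : ℂ)) x v = (fderiv ℝ Q x v : ℂ) := by
  have := (Complex.ofRealCLM.hasFDerivAt (x := Q x)).comp x hQ.hasFDerivAt
  rw [show (fun y => (Q y : ℂ)) = Complex.ofRealCLM ∘ Q from rfl, this.fderiv]
  simp

theorem norm_classicalGrad_ofReal_sq {x : Space n} (hQ : DifferentiableAt ℝ Q x) :
    ‖classicalGrad (fun y => (Q y : ℂ)) x‖ ^ 2
      = ∑ j, fderiv ℝ Q x (EuclideanSpace.single j 1) ^ 2 := by
  rw [EuclideanSpace.norm_sq_eq]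
  simp [classicalGrad, fderiv_ofReal_comp hQ]

theorem IsGroundState.memLp (hQ : IsGroundState Q) : MemLp Q 2 volume := by
  have := hQ.memSobolev.1.re
  simpa using this

theorem IsGroundState.memLp_grad (hQ : IsGroundState Q) :
    MemLp (classicalGrad fun x => (Q x : ℂ)) 2 volume := by
  have h1 : ContDiff ℝ 1 fun x => (Q x : ℂ) := hQ.contDiff_ofReal.of_le one_le_two
  refine ⟨(continuous_classicalGrad h1).aestronglyMeasurable, ?_⟩
  rw [← gradNorm_eq_eLpNorm_classicalGrad h1]
  exact hQ.memSobolev.2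

theorem IsGroundState.integrable_sq (hQ : IsGroundState Q) :
    Integrable (fun x => Q x ^ 2) volume := hQ.memLp.integrable_sq

theorem IsGroundState.integrable_grad_sq (hQ : IsGroundState Q) :
    Integrable (fun x => ‖classicalGrad (fun y => (Q y : ℂ)) x‖ ^ 2) volume :=
  (memLp_two_iff_integrable_sq_norm hQ.memLp_grad.1).1 hQ.memLp_grad

/-- The ground state has a finite second moment, `x Q ∈ L²`. This decay is not part of the
definition; it follows from the equation for the radial profile. -/
theorem IsGroundState.integrable_norm_sq_mul_sq (hQ : IsGroundState Q) (hn : 1 ≤ n) :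
    Integrable (fun x => ‖x‖ ^ 2 * Q x ^ 2) volume := by
  set i : Fin n := ⟨0, hn⟩
  set q := axisProfile Q i
  have hq2 : ContDiff ℝ 2 q := contDiff_axisProfile hQ.contDiff i
  have hq1 : ContDiff ℝ 1 (deriv q) := (contDiff_succ_iff_deriv.1 hq2).2.2
  have hqn : ∀ x, q ‖x‖ = Q x := axisProfile_norm hQ.radial i
  have hqd : ∀ r, HasDerivAt q (deriv q r) r :=
    fun r => (hq2.differentiable two_ne_zero r).hasDerivAt
  have hqd' : ∀ r, HasDerivAt (deriv q) (deriv (deriv q) r) r :=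
    fun r => (hq1.differentiable one_ne_zero r).hasDerivAt
  have hqpos : ∀ r, 0 < q r := fun r => hQ.pos _
  have h0 : IntegrableOn (fun r => r ^ (n - 1) * q r ^ 2) (Ioi 0) := by
    rw [← integrable_radial_iff hn (f := fun r => q r ^ 2)]
    simpa only [hqn] using hQ.integrable_sq
  have h1 : IntegrableOn (fun r => r ^ (n - 1) * deriv q r ^ 2) (Ioi 0) := by
    rw [← integrable_radial_iff hn (f := fun r => deriv q r ^ 2)]
    refine hQ.integrable_grad_sq.mono'
      ((hq1.continuous.comp continuous_norm).pow 2).aestronglyMeasurable ?_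
    have : Nonempty (Fin n) := ⟨i⟩
    filter_upwards [compl_mem_ae_iff.2 (measure_singleton (0 : Space n))] with x hx
    have hx0 : x ≠ 0 := hx
    have hnx : 0 < ‖x‖ := norm_pos_iff.2 hx0
    have h2 := fderiv_radial hQ.contDiff hQ.radial i hx0 x
    rw [real_inner_self_eq_norm_sq, apply_eq_sum_mul] at h2
    have h3 := Finset.sum_mul_sq_le_sq_mul_sq Finset.univ (fun j => x j)
      fun j => fderiv ℝ Q x (EuclideanSpace.single j 1)
    have h4 : ∑ j, x j ^ 2 = ‖x‖ ^ 2 := by simp [EuclideanSpace.norm_sq_eq]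
    rw [h2, h4] at h3
    rw [Real.norm_of_nonneg (by positivity), norm_classicalGrad_ofReal_sq (hQ.differentiableAt x)]
    refine le_of_mul_le_mul_left (le_of_eq_of_le ?_ h3) (pow_pos hnx 2)
    field_simp
    rfl
  have hlim : Tendsto q atTop (𝓝 0) :=
    tendsto_zero_of_integrableOn_sq hqd hq1.continuous (h0.mono_set (Ioi_subset_Ioi zero_le_one))
      (h1.mono_set (Ioi_subset_Ioi zero_le_one))
  have hn0 : (0 : ℝ) < 4 / n := by positivity
  -- beyond some radius the nonlinear term is at most half of the linear one
  have hsmall : ∀ᶠ r in atTop, q r ^ (4 / (n : ℝ)) < 1 / 2 := by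
    have := hlim.rpow_const (p := 4 / (n : ℝ)) (Or.inr hn0.le)
    rw [Real.zero_rpow hn0.ne'] at this
    exact this.eventually (gt_mem_nhds (by norm_num))
  obtain ⟨R₀, hR₀⟩ := eventually_atTop.1 hsmall
  set R := max R₀ 1
  have hR : 0 < R := zero_lt_one.trans_le (le_max_right _ _)
  have hode : ∀ r, R ≤ r → q r / 2 ≤ deriv (deriv q) r + (n - 1 : ℕ) / r * deriv q r := by
    intro r hr
    have hr0 : 0 < r := hR.trans_le hr
    rw [← laplacian_radial hQ.contDiff hQ.radial i hr0]
    have he := hQ.equation (r • EuclideanSpace.single i 1)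
    rw [Real.rpow_add (hQ.pos _), Real.rpow_one] at he
    have hs := hR₀ r ((le_max_left _ _).trans hr)
    have hp := hqpos r
    change -q r = _ - q r * q r ^ (4 / (n : ℝ)) at he
    nlinarith
  obtain ⟨R₁, hR₁, hint⟩ := exists_integrableOn_Ioi_pow_mul hR hqd hqd' hqpos hlim hode
  -- far out `q ≤ 1`, so that `q² ≤ q`
  obtain ⟨R₂, hR₂⟩ := eventually_atTop.1 (hlim.eventually (gt_mem_nhds zero_lt_one))
  set R₃ := max R₁ R₂
  have hR₃ : 0 < R₃ := hR₁.trans_le (le_max_left _ _)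
  have hcont : Continuous fun r : ℝ => r ^ (n - 1) * (r ^ 2 * q r ^ 2) := by
    have := hq2.continuous
    fun_prop
  have hfar : IntegrableOn (fun r : ℝ => r ^ (n - 1) * (r ^ 2 * q r ^ 2)) (Ioi R₃) := by
    refine (hint.mono_set (Ioi_subset_Ioi (le_max_left _ _))).mono' hcont.aestronglyMeasurable ?_
    filter_upwards [ae_restrict_mem measurableSet_Ioi] with r hr
    have hr' : R₃ < r := hr
    have hr0 : 0 < r := hR₃.trans hr'
    have h2 := hR₂ r ((le_max_right _ _).trans hr'.le)
    have hp := hqpos r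
    rw [Real.norm_of_nonneg (by positivity), ← mul_assoc, ← pow_add]
    gcongr
    nlinarith
  have hall : IntegrableOn (fun r : ℝ => r ^ (n - 1) * (r ^ 2 * q r ^ 2)) (Ioi 0) := by
    rw [← Ioc_union_Ioi_eq_Ioi hR₃.le]
    exact hcont.integrableOn_Ioc.union hfar
  have := (integrable_radial_iff hn (f := fun r => r ^ 2 * q r ^ 2)).2 hall
  simpa only [hqn] using this

/-! ### Rotations generated by skew-symmetric matrices -/

theorem inner_mulMat (A : Matrix (Fin n) (Fin n) ℝ) (x y : Space n) :
    inner ℝ (mulMat A x) y = inner ℝ x (mulMat A.transpose y) := by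
  unfold mulMat
  rw [← Matrix.conjTranspose_eq_transpose_of_trivial,
    Matrix.toEuclideanLin_conjTranspose_eq_adjoint, LinearMap.adjoint_inner_right]

theorem mulMat_mul (A B : Matrix (Fin n) (Fin n) ℝ) (x : Space n) :
    mulMat (A * B) x = mulMat A (mulMat B x) := by
  simp [mulMat, Matrix.toLpLin_apply, Matrix.mulVec_mulVec]

theorem inner_mulMat_self_of_skew {M : Matrix (Fin n) (Fin n) ℝ} (hM : M.transpose = -M)
    (x : Space n) : inner ℝ x (mulMat M x) = 0 := by
  have h := inner_mulMat M x x
  have h1 : mulMat (-M) x = -mulMat M x := by simp [mulMat]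
  rw [hM, h1, inner_neg_right, real_inner_comm] at h
  linarith

theorem norm_mulMat_exp_of_skew {M : Matrix (Fin n) (Fin n) ℝ} (hM : M.transpose = -M) (t : ℝ)
    (x : Space n) : ‖mulMat (NormedSpace.exp (t • M)) x‖ = ‖x‖ := by
  have h1 : (NormedSpace.exp (t • M)).transpose * NormedSpace.exp (t • M) = 1 := by
    rw [← Matrix.exp_transpose, Matrix.transpose_smul, hM, smul_neg, Matrix.exp_neg]
    exact Matrix.nonsing_inv_mul _ ((Matrix.isUnit_iff_isUnit_det _).1 (Matrix.isUnit_exp _))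
  have h2 := inner_mulMat (NormedSpace.exp (t • M)) x (mulMat (NormedSpace.exp (t • M)) x)
  rw [← mulMat_mul, h1, real_inner_self_eq_norm_sq] at h2
  have h3 : mulMat 1 x = x := by simp [mulMat]
  rw [h3, real_inner_self_eq_norm_sq] at h2
  exact (sq_eq_sq₀ (norm_nonneg _) (norm_nonneg _)).1 h2

/-! ### Rescaled profiles with a quadratic phase -/

/-- The rescaled profile `w exp(-i b |x|²) Q(c x)` with a quadratic phase. -/
def chirp (w : ℂ) (b c : ℝ) (Q : Space n → ℝ) (x : Space n) : ℂ :=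
  w * Complex.exp (-Complex.I * ((b * ‖x‖ ^ 2 : ℝ) : ℂ)) * (Q (c • x) : ℂ)

theorem contDiff_quadraticPhase (b : ℝ) :
    ContDiff ℝ 2 fun x : Space n => Complex.exp (-Complex.I * ((b * ‖x‖ ^ 2 : ℝ) : ℂ)) := by
  have h : ContDiff ℝ 2 fun x : Space n => ((b * ‖x‖ ^ 2 : ℝ) : ℂ) :=
    Complex.ofRealCLM.contDiff.comp (contDiff_const.mul (contDiff_norm_sq ℝ))
  exact (contDiff_const.mul h).cexp

theorem contDiff_chirp (hQ : ContDiff ℝ 2 Q) (w : ℂ) (b c : ℝ) : ContDiff ℝ 2 (chirp w b c Q) := by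
  have h : ContDiff ℝ 2 fun x : Space n => (Q (c • x) : ℂ) :=
    Complex.ofRealCLM.contDiff.comp (hQ.comp (contDiff_const_smul c))
  exact (contDiff_const.mul (contDiff_quadraticPhase b)).mul h

theorem norm_chirp (hQ : ∀ x, 0 < Q x) (w : ℂ) (b c : ℝ) (x : Space n) :
    ‖chirp w b c Q x‖ = ‖w‖ * Q (c • x) := by
  have h : ‖Complex.exp (-Complex.I * ((b * ‖x‖ ^ 2 : ℝ) : ℂ))‖ = 1 := by
    rw [neg_mul, ← mul_neg, mul_comm, ← Complex.ofReal_neg, Complex.norm_exp_ofReal_mul_I]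
  rw [chirp, norm_mul, norm_mul, h, mul_one, Complex.norm_real, Real.norm_of_nonneg (hQ _).le]

theorem hasLineDerivAt_quadraticPhase (b : ℝ) (x : Space n) (j : Fin n) :
    HasLineDerivAt ℝ (fun x : Space n => Complex.exp (-Complex.I * ((b * ‖x‖ ^ 2 : ℝ) : ℂ)))
      (Complex.exp (-Complex.I * ((b * ‖x‖ ^ 2 : ℝ) : ℂ)) * (-Complex.I * (2 * b * x j : ℝ)))
      x (EuclideanSpace.single j 1) := by
  have h1 := ((hasStrictFDerivAt_norm_sq x).hasFDerivAt.hasLineDerivAt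
    (EuclideanSpace.single j (1 : ℝ)))
  unfold HasLineDerivAt at h1 ⊢
  have h2 := (((h1.const_mul b).ofReal_comp).const_mul (-Complex.I)).cexp
  convert! h2 using 1
  simp [EuclideanSpace.inner_single_right]
  ring

theorem hasLineDerivAt_ofReal_comp_smul {f : Space n → ℝ} {c : ℝ} {x : Space n}
    (hf : DifferentiableAt ℝ f (c • x)) (v : Space n) :
    HasLineDerivAt ℝ (fun x => (f (c • x) : ℂ)) ((c * fderiv ℝ f (c • x) v : ℝ) : ℂ) x v := by
  have h1 : HasFDerivAt (fun x : Space n => c • x) (c • ContinuousLinearMap.id ℝ (Space n)) x :=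
    (hasFDerivAt_id x).const_smul c
  have h2 := (hf.hasFDerivAt.comp x h1).hasLineDerivAt v
  unfold HasLineDerivAt at h2 ⊢
  convert! h2.ofReal_comp using 1
  simp

theorem hasLineDerivAt_chirp (hQ : Differentiable ℝ Q) (w : ℂ) (b c : ℝ) (x : Space n)
    (j : Fin n) :
    HasLineDerivAt ℝ (chirp w b c Q)
      (w * Complex.exp (-Complex.I * ((b * ‖x‖ ^ 2 : ℝ) : ℂ))
        * (((c * fderiv ℝ Q (c • x) (EuclideanSpace.single j 1) : ℝ) : ℂ)
          + (-Complex.I * (2 * b * x j : ℝ)) * (Q (c • x) : ℂ)))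
      x (EuclideanSpace.single j 1) := by
  have h1 := hasLineDerivAt_quadraticPhase b x j
  have h2 := hasLineDerivAt_ofReal_comp_smul (c := c) (hQ (c • x)) (EuclideanSpace.single j 1)
  unfold HasLineDerivAt at h1 h2 ⊢
  have h3 := (h1.const_mul w).mul h2
  convert! h3 using 1
  simp only [zero_smul, add_zero]
  ring

theorem laplacian_chirp (hQ : ContDiff ℝ 2 Q) (w : ℂ) (b c : ℝ) (x : Space n) :
    (Δ (chirp w b c Q)) x = w * Complex.exp (-Complex.I * ((b * ‖x‖ ^ 2 : ℝ) : ℂ))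
      * (((c ^ 2 * (Δ Q) (c • x) : ℝ) : ℂ)
        - Complex.I * ((4 * b * (c * fderiv ℝ Q (c • x) x) : ℝ) : ℂ)
        - Complex.I * ((2 * b * n * Q (c • x) : ℝ) : ℂ)
        - ((4 * b ^ 2 * ‖x‖ ^ 2 * Q (c • x) : ℝ) : ℂ)) := by
  have hQd := hQ.differentiable two_ne_zero
  set q₁ : Fin n → Space n → ℝ := fun j y => fderiv ℝ Q y (EuclideanSpace.single j 1) with hq₁
  have hq₁d : ∀ j, Differentiable ℝ (q₁ j) := fun j =>
    ((hQ.fderiv_right (m := 1) (by norm_num)).differentiable one_ne_zero).clm_apply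
      (differentiable_const _)
  set q₂ : Fin n → ℝ := fun j => fderiv ℝ (q₁ j) (c • x) (EuclideanSpace.single j 1) with hq₂
  have hlap : (Δ Q) (c • x) = ∑ j, q₂ j :=
    laplacian_eq_sum_of_hasLineDerivAt hQ (fun j y => (hQd y).hasFDerivAt.hasLineDerivAt _)
      fun j => (hq₁d j _).hasFDerivAt.hasLineDerivAt _
  have hfd : fderiv ℝ Q (c • x) x = ∑ j, x j * q₁ j (c • x) := apply_eq_sum_mul _ _
  have hnorm : ‖x‖ ^ 2 = ∑ j, x j ^ 2 := by simp [EuclideanSpace.norm_sq_eq]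
  set E := Complex.exp (-Complex.I * ((b * ‖x‖ ^ 2 : ℝ) : ℂ)) with hE
  rw [laplacian_eq_sum_of_hasLineDerivAt (contDiff_chirp hQ w b c)
    (f₂ := fun j => w * E * (((c ^ 2 * q₂ j : ℝ) : ℂ)
      - Complex.I * ((4 * b * (c * (x j * q₁ j (c • x))) : ℝ) : ℂ)
      - Complex.I * ((2 * b * Q (c • x) : ℝ) : ℂ) - ((4 * b ^ 2 * x j ^ 2 * Q (c • x) : ℝ) : ℂ)))
    (fun j y => hasLineDerivAt_chirp hQd w b c y j)]
  · rw [← Finset.mul_sum, Finset.sum_sub_distrib, Finset.sum_sub_distrib, Finset.sum_sub_distrib,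
      ← Finset.mul_sum, ← Finset.mul_sum, hlap, hfd, hnorm]
    simp only [← Complex.ofReal_sum, ← Finset.mul_sum, ← Finset.sum_mul, Finset.sum_const,
      Finset.card_univ, Fintype.card_fin, nsmul_eq_mul]
    push_cast
    ring
  · intro j
    have h1 := hasLineDerivAt_quadraticPhase b x j
    have h2 := hasLineDerivAt_ofReal_comp_smul (c := c) (hQd (c • x)) (EuclideanSpace.single j 1)
    have h3 := hasLineDerivAt_ofReal_comp_smul (c := c) (hq₁d j (c • x)) (EuclideanSpace.single j 1)
    have h4 := ((EuclideanSpace.proj (𝕜 := ℝ) j).hasFDerivAt (x := x)).hasLineDerivAt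
      (EuclideanSpace.single j (1 : ℝ))
    unfold HasLineDerivAt at h1 h2 h3 h4 ⊢
    have h5 := (h1.const_mul w).mul ((h3.const_mul (c : ℂ)).add
      ((((h4.const_mul (2 * b)).ofReal_comp).const_mul (-Complex.I)).mul h2))
    convert! h5 using 1
    · ext t
      simp [hq₁]
    · simp only [Pi.add_apply, Pi.mul_apply, zero_smul, add_zero, PiLp.proj_apply,
        PiLp.single_apply, if_true, ← hE]
      clear_value E
      simp only [hq₁, hq₂]
      push_cast
      linear_combination (-4 * w * E * b ^ 2 * x j ^ 2 * Q (c • x)) * Complex.I_sq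

theorem classicalGrad_chirp (hQ : ContDiff ℝ 2 Q) (w : ℂ) (b c : ℝ) (x : Space n) (j : Fin n) :
    classicalGrad (chirp w b c Q) x j = w * Complex.exp (-Complex.I * ((b * ‖x‖ ^ 2 : ℝ) : ℂ))
        * (((c * fderiv ℝ Q (c • x) (EuclideanSpace.single j 1) : ℝ) : ℂ)
          + (-Complex.I * (2 * b * x j : ℝ)) * (Q (c • x) : ℂ)) :=
  ((((contDiff_chirp hQ w b c).differentiable two_ne_zero x).hasFDerivAt.hasLineDerivAt
    _).lineDeriv).symm.trans
    (hasLineDerivAt_chirp (hQ.differentiable two_ne_zero) w b c x j).lineDeriv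

/-- The gradient of the profile and that of the quadratic phase are orthogonal, as one is real and
the other imaginary relative to the common phase factor. -/
theorem norm_classicalGrad_chirp_sq (hQ : ContDiff ℝ 2 Q) (w : ℂ) (b c : ℝ) (x : Space n) :
    ‖classicalGrad (chirp w b c Q) x‖ ^ 2 = ‖w‖ ^ 2 *
      (c ^ 2 * ‖classicalGrad (fun y => (Q y : ℂ)) (c • x)‖ ^ 2
        + 4 * b ^ 2 * (‖x‖ ^ 2 * Q (c • x) ^ 2)) := by
  have hE : ‖Complex.exp (-Complex.I * ((b * ‖x‖ ^ 2 : ℝ) : ℂ))‖ = 1 := by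
    rw [neg_mul, ← mul_neg, mul_comm, ← Complex.ofReal_neg, Complex.norm_exp_ofReal_mul_I]
  have hj : ∀ j, ‖classicalGrad (chirp w b c Q) x j‖ ^ 2 = ‖w‖ ^ 2 *
      (c ^ 2 * fderiv ℝ Q (c • x) (EuclideanSpace.single j 1) ^ 2
        + 4 * b ^ 2 * (x j ^ 2 * Q (c • x) ^ 2)) := by
    intro j
    have h : ∀ p q r : ℝ, ‖(p : ℂ) + (-Complex.I * (q : ℂ)) * (r : ℂ)‖ ^ 2
        = p ^ 2 + (q * r) ^ 2 := by
      intro p q r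
      rw [← Complex.normSq_eq_norm_sq, Complex.normSq_apply]
      simp
      ring
    rw [classicalGrad_chirp hQ, norm_mul, norm_mul, hE, mul_one, mul_pow, h]
    ring
  rw [EuclideanSpace.norm_sq_eq, norm_classicalGrad_ofReal_sq (hQ.differentiable two_ne_zero _),
    EuclideanSpace.norm_sq_eq]
  simp only [hj, ← Finset.mul_sum, Finset.sum_add_distrib, ← Finset.sum_mul, Real.norm_eq_abs,
    sq_abs]

/-! ### Norms of rescaled ground states -/

theorem integrable_comp_smul_and_integral {f : Space n → ℝ} (hf : Integrable f volume) {c : ℝ}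
    (hc : 0 < c) : Integrable (fun x => f (c • x)) volume ∧
      c ^ n * ∫ x, f (c • x) = ∫ x, f x := by
  refine ⟨hf.comp_smul hc.ne', ?_⟩
  have h := Measure.integral_comp_smul_of_nonneg (volume : Measure (Space n)) f c (hR := hc.le)
  rw [finrank_euclideanSpace_fin, smul_eq_mul] at h
  rw [h, mul_inv_cancel_left₀ (pow_pos hc n).ne']

variable {w : ℂ} {b c : ℝ}

theorem IsGroundState.memLp_chirp (hQ : IsGroundState Q) (hc : 0 < c) (hw : ‖w‖ ^ 2 = c ^ n) :
    MemLp (chirp w b c Q) 2 volume ∧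
      eLpNorm (chirp w b c Q) 2 volume = ENNReal.ofReal (√(∫ x, Q x ^ 2)) := by
  obtain ⟨h1, h2⟩ := integrable_comp_smul_and_integral hQ.integrable_sq hc
  have h3 : ∀ x, ‖chirp w b c Q x‖ ^ 2 = c ^ n * Q (c • x) ^ 2 := fun x => by
    rw [norm_chirp hQ.pos, mul_pow, hw]
  have h4 : MemLp (chirp w b c Q) 2 volume := by
    rw [memLp_two_iff_integrable_sq_norm
      (contDiff_chirp hQ.contDiff w b c).continuous.aestronglyMeasurable]
    simp only [h3]
    exact h1.const_mul _
  refine ⟨h4, ?_⟩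
  rw [eLpNorm_two_eq_ofReal_sqrt h4]
  simp only [h3]
  rw [integral_const_mul, h2]

theorem IsGroundState.memLp_norm_smul_chirp (hQ : IsGroundState Q) (hn : 1 ≤ n) (hc : 0 < c)
    (hw : ‖w‖ ^ 2 = c ^ n) :
    MemLp (fun x => ‖x‖ • chirp w b c Q x) 2 volume ∧
      eLpNorm (fun x => ‖x‖ • chirp w b c Q x) 2 volume
        = ENNReal.ofReal (√((∫ x, ‖x‖ ^ 2 * Q x ^ 2) / c ^ 2)) := by
  obtain ⟨h1, h2⟩ := integrable_comp_smul_and_integral (hQ.integrable_norm_sq_mul_sq hn) hc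
  have h3 : ∀ x, ‖‖x‖ • chirp w b c Q x‖ ^ 2
      = c ^ n * (‖c • x‖ ^ 2 * Q (c • x) ^ 2) / c ^ 2 := fun x => by
    rw [norm_smul, norm_chirp hQ.pos, mul_pow, mul_pow, hw, norm_smul, norm_norm,
      Real.norm_of_nonneg hc.le]
    field_simp
  have h4 : MemLp (fun x => ‖x‖ • chirp w b c Q x) 2 volume := by
    have hcont : Continuous fun x => ‖x‖ • chirp w b c Q x :=
      continuous_norm.smul (contDiff_chirp hQ.contDiff w b c).continuous
    rw [memLp_two_iff_integrable_sq_norm hcont.aestronglyMeasurable]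
    simp only [h3]
    exact (h1.const_mul _).div_const _
  refine ⟨h4, ?_⟩
  rw [eLpNorm_two_eq_ofReal_sqrt h4]
  simp only [h3]
  rw [integral_div, integral_const_mul, h2]

theorem IsGroundState.memLp_grad_chirp (hQ : IsGroundState Q) (hn : 1 ≤ n) (hc : 0 < c)
    (hw : ‖w‖ ^ 2 = c ^ n) :
    MemLp (classicalGrad (chirp w b c Q)) 2 volume ∧
      eLpNorm (classicalGrad (chirp w b c Q)) 2 volume
        = ENNReal.ofReal (√(c ^ 2 * (∫ x, ‖classicalGrad (fun y => (Q y : ℂ)) x‖ ^ 2)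
          + 4 * b ^ 2 / c ^ 2 * ∫ x, ‖x‖ ^ 2 * Q x ^ 2)) := by
  obtain ⟨h1, h2⟩ := integrable_comp_smul_and_integral (hQ.integrable_norm_sq_mul_sq hn) hc
  obtain ⟨h1', h2'⟩ := integrable_comp_smul_and_integral hQ.integrable_grad_sq hc
  have h3 : ∀ x, ‖classicalGrad (chirp w b c Q) x‖ ^ 2
      = c ^ 2 * (c ^ n * ‖classicalGrad (fun y => (Q y : ℂ)) (c • x)‖ ^ 2)
        + 4 * b ^ 2 / c ^ 2 * (c ^ n * (‖c • x‖ ^ 2 * Q (c • x) ^ 2)) := fun x => by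
    rw [norm_classicalGrad_chirp_sq hQ.contDiff, hw, norm_smul, Real.norm_of_nonneg hc.le]
    field_simp
  have h4 : MemLp (classicalGrad (chirp w b c Q)) 2 volume := by
    rw [memLp_two_iff_integrable_sq_norm (continuous_classicalGrad
      ((contDiff_chirp hQ.contDiff w b c).of_le one_le_two)).aestronglyMeasurable]
    simp only [h3]
    exact ((h1'.const_mul _).const_mul _).add ((h1.const_mul _).const_mul _)
  refine ⟨h4, ?_⟩
  rw [eLpNorm_two_eq_ofReal_sqrt h4]
  simp only [h3]
  rw [integral_add ((h1'.const_mul _).const_mul _) ((h1.const_mul _).const_mul _),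
    integral_const_mul, integral_const_mul, integral_const_mul, integral_const_mul, h2, h2']

/-- A ground state is not constant, since it is in `L²`. -/
theorem IsGroundState.integral_grad_sq_pos (hQ : IsGroundState Q) (hn : 1 ≤ n) :
    0 < ∫ x, ‖classicalGrad (fun y => (Q y : ℂ)) x‖ ^ 2 := by
  have hcont := continuous_classicalGrad (hQ.contDiff_ofReal.of_le one_le_two)
  refine lt_of_le_of_ne (integral_nonneg fun x => sq_nonneg _) fun h => ?_
  have h1 : (fun x => ‖classicalGrad (fun y => (Q y : ℂ)) x‖ ^ 2) =ᵐ[volume] 0 :=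
    (integral_eq_zero_iff_of_nonneg (fun x => sq_nonneg _) hQ.integrable_grad_sq).1 h.symm
  have h2 : (fun x => ‖classicalGrad (fun y => (Q y : ℂ)) x‖ ^ 2) = 0 :=
    (Continuous.ae_eq_iff_eq volume (hcont.norm.pow 2) continuous_zero).1 h1
  have h3 : ∀ x, fderiv ℝ Q x = 0 := by
    intro x
    have h4 := congrFun h2 x
    rw [norm_classicalGrad_ofReal_sq (hQ.differentiableAt x), Pi.zero_apply,
      Finset.sum_eq_zero_iff_of_nonneg fun j _ => sq_nonneg _] at h4
    ext v
    rw [apply_eq_sum_mul]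
    exact Finset.sum_eq_zero fun j hj => by
      rw [pow_eq_zero_iff two_ne_zero |>.1 (h4 j hj), mul_zero]
  have h5 : ∀ x, Q x = Q 0 := fun x =>
    is_const_of_fderiv_eq_zero (fun x => hQ.differentiableAt x) h3 x 0
  have h6 := hQ.integrable_sq
  simp only [h5] at h6
  have : Nonempty (Fin n) := ⟨⟨0, hn⟩⟩
  have : NoncompactSpace (Space n) := NormedSpace.noncompactSpace ℝ _
  rcases integrable_const_iff.1 h6 with h7 | h7
  · exact (pow_pos (hQ.pos 0) 2).ne' h7
  · have := h7.measure_univ_lt_top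
    simp at this

/-! ### The lens transform of the ground state -/

variable {γ t : ℝ}

/-- The spatially constant factor `cos(2γt)^(-n/2) exp(i tan(2γt) / (2γ))` of the transformed
solitary wave. -/
def lensAmplitude (n : ℕ) (γ t : ℝ) : ℂ :=
  ((1 / Real.cos (2 * γ * t) ^ ((n : ℝ) / 2) : ℝ) : ℂ)
    * Complex.exp (Complex.I * ((Real.tan (2 * γ * t) / (2 * γ) : ℝ) : ℂ))

/-- The transformed solitary wave without the rotation, which a radial function does not see. -/
def lensWave (γ : ℝ) (Q : Space n → ℝ) (t : ℝ) : Space n → ℂ :=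
  chirp (lensAmplitude n γ t) (γ / 2 * Real.tan (2 * γ * t)) (Real.cos (2 * γ * t))⁻¹ Q

theorem rTransform_solitaryWave_eq_lensWave (hQ : IsGroundState Q)
    {M : Matrix (Fin n) (Fin n) ℝ} (hM : M.transpose = -M) :
    rTransform γ M (solitaryWave Q) = lensWave γ Q := by
  ext t x
  have h : Q ((Real.cos (2 * γ * t))⁻¹ • mulMat (NormedSpace.exp (t • M)) x)
      = Q ((Real.cos (2 * γ * t))⁻¹ • x) :=
    hQ.radial _ _ (by rw [norm_smul, norm_smul, norm_mulMat_exp_of_skew hM])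
  simp only [rTransform, solitaryWave, lensWave, chirp, lensAmplitude, h]
  rw [mul_right_comm (γ / 2)]
  ring

theorem cos_pos_of_mem_Ico (hγ : 0 < γ) (ht : t ∈ Ico 0 (Real.pi / (4 * γ))) :
    0 < Real.cos (2 * γ * t) := by
  have h2 : t * (4 * γ) < Real.pi := (lt_div_iff₀ (by positivity)).1 ht.2
  have h1 : 0 ≤ γ * t := mul_nonneg hγ.le ht.1
  exact Real.cos_pos_of_mem_Ioo ⟨by linarith [Real.pi_pos], by linarith⟩

theorem norm_lensAmplitude (hc : 0 < Real.cos (2 * γ * t)) :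
    ‖lensAmplitude n γ t‖ = (Real.cos (2 * γ * t))⁻¹ ^ ((n : ℝ) / 2) := by
  rw [lensAmplitude, norm_mul, mul_comm Complex.I, Complex.norm_exp_ofReal_mul_I, mul_one,
    Complex.norm_real, Real.norm_of_nonneg (by positivity), one_div, Real.inv_rpow hc.le]

theorem norm_lensAmplitude_sq (hc : 0 < Real.cos (2 * γ * t)) :
    ‖lensAmplitude n γ t‖ ^ 2 = (Real.cos (2 * γ * t))⁻¹ ^ n := by
  rw [norm_lensAmplitude hc, ← Real.rpow_natCast, ← Real.rpow_mul (inv_nonneg.2 hc.le),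
    ← Real.rpow_natCast]
  norm_num

theorem hasDerivAt_cos_inv (hc : 0 < Real.cos (2 * γ * t)) :
    HasDerivAt (fun s => (Real.cos (2 * γ * s))⁻¹)
      (2 * γ * Real.tan (2 * γ * t) * (Real.cos (2 * γ * t))⁻¹) t := by
  have h1 : HasDerivAt (fun s => 2 * γ * s) (2 * γ) t := by
    simpa using (hasDerivAt_id t).const_mul (2 * γ)
  convert! h1.cos.fun_inv hc.ne' using 1
  rw [Real.tan_eq_sin_div_cos]
  field_simp

theorem hasDerivAt_tan_mul (hc : 0 < Real.cos (2 * γ * t)) :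
    HasDerivAt (fun s => Real.tan (2 * γ * s)) (2 * γ * (Real.cos (2 * γ * t))⁻¹ ^ 2) t := by
  have h1 : HasDerivAt (fun s => 2 * γ * s) (2 * γ) t := by
    simpa using (hasDerivAt_id t).const_mul (2 * γ)
  convert! (Real.hasDerivAt_tan hc.ne').comp t h1 using 1
  field_simp

theorem hasDerivAt_lensAmplitude (hγ : 0 < γ) (hc : 0 < Real.cos (2 * γ * t)) :
    HasDerivAt (lensAmplitude n γ)
      (lensAmplitude n γ t * (((n * γ * Real.tan (2 * γ * t) : ℝ) : ℂ)
        + Complex.I * (((Real.cos (2 * γ * t))⁻¹ ^ 2 : ℝ) : ℂ))) t := by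
  have h1 : HasDerivAt (fun s => 2 * γ * s) (2 * γ) t := by
    simpa using (hasDerivAt_id t).const_mul (2 * γ)
  have h2 : HasDerivAt (fun s => 1 / Real.cos (2 * γ * s) ^ ((n : ℝ) / 2))
      (1 / Real.cos (2 * γ * t) ^ ((n : ℝ) / 2) * (n * γ * Real.tan (2 * γ * t))) t := by
    simp only [one_div]
    have hp : Real.cos (2 * γ * t) ^ ((n : ℝ) / 2) ≠ 0 := (Real.rpow_pos_of_pos hc _).ne'
    convert! (h1.cos.rpow_const (p := (n : ℝ) / 2) (Or.inl hc.ne')).fun_inv hp using 1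
    rw [Real.rpow_sub_one hc.ne', Real.tan_eq_sin_div_cos]
    field_simp
  have h3 := (((hasDerivAt_tan_mul hc).div_const (2 * γ)).ofReal_comp.const_mul Complex.I).cexp
  convert! h2.ofReal_comp.mul h3 using 1
  rw [lensAmplitude, mul_div_cancel_left₀ _ (by positivity : 2 * γ ≠ 0)]
  push_cast
  ring

theorem hasDerivAt_chirp {w : ℝ → ℂ} {b c : ℝ → ℝ} {w' : ℂ} {b' c' : ℝ}
    (hw : HasDerivAt w w' t) (hb : HasDerivAt b b' t) (hc : HasDerivAt c c' t) {x : Space n}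
    (hQ : DifferentiableAt ℝ Q (c t • x)) :
    HasDerivAt (fun s => chirp (w s) (b s) (c s) Q x)
      (Complex.exp (-Complex.I * ((b t * ‖x‖ ^ 2 : ℝ) : ℂ))
        * ((w' - w t * (Complex.I * ((b' * ‖x‖ ^ 2 : ℝ) : ℂ))) * (Q (c t • x) : ℂ)
          + w t * ((c' * fderiv ℝ Q (c t • x) x : ℝ) : ℂ))) t := by
  have h1 := (hb.mul_const (‖x‖ ^ 2)).ofReal_comp.const_mul (-Complex.I) |>.cexp
  have h2 := (hQ.hasFDerivAt.comp_hasDerivAt t (hc.smul_const x)).ofReal_comp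
  convert! (hw.mul h1).mul h2 using 1
  simp
  ring

/-- The time derivative of the transformed solitary wave. -/
def lensWaveDeriv (γ : ℝ) (Q : Space n → ℝ) (t : ℝ) (x : Space n) : ℂ :=
  lensAmplitude n γ t
    * Complex.exp (-Complex.I * ((γ / 2 * Real.tan (2 * γ * t) * ‖x‖ ^ 2 : ℝ) : ℂ))
    * ((((n * γ * Real.tan (2 * γ * t) : ℝ) : ℂ)
        + Complex.I * (((Real.cos (2 * γ * t))⁻¹ ^ 2 * (1 - γ ^ 2 * ‖x‖ ^ 2) : ℝ) : ℂ))
          * (Q ((Real.cos (2 * γ * t))⁻¹ • x) : ℂ)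
      + ((2 * γ * Real.tan (2 * γ * t) * (Real.cos (2 * γ * t))⁻¹
          * fderiv ℝ Q ((Real.cos (2 * γ * t))⁻¹ • x) x : ℝ) : ℂ))

theorem hasDerivAt_lensWave (hQ : IsGroundState Q) (hγ : 0 < γ) (hc : 0 < Real.cos (2 * γ * t))
    (x : Space n) : HasDerivAt (fun s => lensWave γ Q s x) (lensWaveDeriv γ Q t x) t := by
  convert! hasDerivAt_chirp (hasDerivAt_lensAmplitude hγ hc)
    ((hasDerivAt_tan_mul hc).const_mul (γ / 2)) (hasDerivAt_cos_inv hc)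
    (hQ.differentiableAt _) (x := x) using 1
  rw [lensWaveDeriv]
  push_cast
  ring

/-- The transformed solitary wave solves the nonlinear Schrödinger equation with the harmonic
potential `γ² |x|²`; the rotation term vanishes on radial functions. -/
theorem lensWave_equation (hQ : IsGroundState Q) (hn : 1 ≤ n)
    (hc : 0 < Real.cos (2 * γ * t)) (x : Space n) :
    Complex.I * lensWaveDeriv γ Q t x = -(Δ (lensWave γ Q t)) x
      + ((γ ^ 2 * ‖x‖ ^ 2 : ℝ) : ℂ) * lensWave γ Q t x
      - ((‖lensWave γ Q t x‖ ^ (4 / (n : ℝ)) : ℝ) : ℂ) * lensWave γ Q t x := by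
  have hn0 : (n : ℝ) ≠ 0 := by positivity
  have htan : Real.tan (2 * γ * t) ^ 2 = (Real.cos (2 * γ * t))⁻¹ ^ 2 - 1 := by
    rw [Real.tan_eq_sin_div_cos, div_pow, Real.sin_sq]
    field_simp
  have hpow : ‖lensWave γ Q t x‖ ^ (4 / (n : ℝ))
      = (Real.cos (2 * γ * t))⁻¹ ^ 2 * Q ((Real.cos (2 * γ * t))⁻¹ • x) ^ (4 / (n : ℝ)) := by
    rw [lensWave, norm_chirp hQ.pos, Real.mul_rpow (norm_nonneg _) (hQ.pos _).le,
      norm_lensAmplitude hc, ← Real.rpow_mul (inv_nonneg.2 hc.le)]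
    congr 1
    rw [← Real.rpow_natCast]
    congr 1
    field_simp
    norm_num
  have heq := hQ.equation ((Real.cos (2 * γ * t))⁻¹ • x)
  rw [Real.rpow_add (hQ.pos _), Real.rpow_one] at heq
  have hΔ : (Δ Q) ((Real.cos (2 * γ * t))⁻¹ • x) = Q ((Real.cos (2 * γ * t))⁻¹ • x)
      - Q ((Real.cos (2 * γ * t))⁻¹ • x)
        * Q ((Real.cos (2 * γ * t))⁻¹ • x) ^ (4 / (n : ℝ)) := by linarith
  rw [hpow, lensWave, laplacian_chirp hQ.contDiff, hΔ, lensWaveDeriv, chirp]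
  generalize (lensAmplitude n γ t) = W
  generalize Complex.exp (-Complex.I * ((γ / 2 * Real.tan (2 * γ * t) * ‖x‖ ^ 2 : ℝ) : ℂ)) = E
  generalize Q ((Real.cos (2 * γ * t))⁻¹ • x) ^ (4 / (n : ℝ)) = P
  generalize Q ((Real.cos (2 * γ * t))⁻¹ • x) = q
  generalize fderiv ℝ Q ((Real.cos (2 * γ * t))⁻¹ • x) x = D
  generalize (Real.cos (2 * γ * t))⁻¹ = c at *
  generalize Real.tan (2 * γ * t) = τ at *
  have htan' : (τ : ℂ) ^ 2 = (c : ℂ) ^ 2 - 1 := by exact_mod_cast htan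
  push_cast
  linear_combination (W * E * c ^ 2 * (1 - γ ^ 2 * ‖x‖ ^ 2) * q) * Complex.I_sq
    - (W * E * γ ^ 2 * ‖x‖ ^ 2 * q) * htan'

theorem continuousOn_lensWaveDeriv (hQ : IsGroundState Q) (hγ : 0 < γ) :
    ContinuousOn (fun p : ℝ × Space n => lensWaveDeriv γ Q p.1 p.2)
      (Ico 0 (Real.pi / (4 * γ)) ×ˢ univ) := by
  have hfst : MapsTo Prod.fst (Ico 0 (Real.pi / (4 * γ)) ×ˢ (univ : Set (Space n)))
      (Ico 0 (Real.pi / (4 * γ))) := fun p hp => hp.1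
  have hA : ContinuousOn (fun p : ℝ × Space n => lensAmplitude n γ p.1)
      (Ico 0 (Real.pi / (4 * γ)) ×ˢ univ) :=
    ContinuousOn.comp (g := lensAmplitude n γ) (fun s hs => (hasDerivAt_lensAmplitude hγ
      (cos_pos_of_mem_Ico hγ hs)).continuousAt.continuousWithinAt) continuousOn_fst hfst
  have hT : ContinuousOn (fun p : ℝ × Space n => Real.tan (2 * γ * p.1))
      (Ico 0 (Real.pi / (4 * γ)) ×ˢ univ) :=
    ContinuousOn.comp (g := fun s => Real.tan (2 * γ * s)) (fun s hs => (hasDerivAt_tan_mul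
      (cos_pos_of_mem_Ico hγ hs)).continuousAt.continuousWithinAt) continuousOn_fst hfst
  have hC : ContinuousOn (fun p : ℝ × Space n => (Real.cos (2 * γ * p.1))⁻¹)
      (Ico 0 (Real.pi / (4 * γ)) ×ˢ univ) :=
    ContinuousOn.comp (g := fun s => (Real.cos (2 * γ * s))⁻¹) (fun s hs => (hasDerivAt_cos_inv
      (cos_pos_of_mem_Ico hγ hs)).continuousAt.continuousWithinAt) continuousOn_fst hfst
  have hx : ContinuousOn (fun p : ℝ × Space n => (Real.cos (2 * γ * p.1))⁻¹ • p.2)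
      (Ico 0 (Real.pi / (4 * γ)) ×ˢ univ) := hC.smul continuousOn_snd
  have hq := hQ.contDiff.continuous.comp_continuousOn hx
  have hd := (hQ.contDiff_one.continuous_fderiv one_ne_zero).comp_continuousOn hx
  have hofReal : ∀ f : ℝ × Space n → ℝ, ContinuousOn f (Ico 0 (Real.pi / (4 * γ)) ×ˢ univ) →
      ContinuousOn (fun p => (f p : ℂ)) (Ico 0 (Real.pi / (4 * γ)) ×ˢ univ) :=
    fun f hf => Complex.continuous_ofReal.comp_continuousOn hf
  simp only [Function.comp_def] at hq hd
  have hD := hd.clm_apply (continuousOn_snd (s := Ico 0 (Real.pi / (4 * γ)) ×ˢ univ))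
  unfold lensWaveDeriv
  refine (hA.mul (continuousOn_const.mul (hofReal _ ?_)).cexp).mul
    ((((hofReal _ ?_).add (continuousOn_const.mul (hofReal _ ?_))).mul (hofReal _ hq)).add
      (hofReal _ ((((continuousOn_const.mul hT).mul hC)).mul hD)))
  · exact (continuousOn_const.mul hT).mul (by fun_prop)
  · exact continuousOn_const.mul hT
  · exact (hC.pow 2).mul (by fun_prop)

theorem contDiff_lensWave (hQ : IsGroundState Q) (γ t : ℝ) : ContDiff ℝ 2 (lensWave γ Q t) :=
  contDiff_chirp hQ.contDiff _ _ _

theorem lensWave_radial (hQ : IsGroundState Q) (γ t : ℝ) (x y : Space n) (h : ‖x‖ = ‖y‖) :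
    lensWave γ Q t x = lensWave γ Q t y := by
  unfold lensWave chirp
  rw [h, hQ.radial _ ((Real.cos (2 * γ * t))⁻¹ • y) (by rw [norm_smul, norm_smul, h])]

theorem tendsto_classicalGrad_lensWave (hQ : IsGroundState Q) (hγ : 0 < γ)
    (hc : 0 < Real.cos (2 * γ * t)) (x : Space n) :
    Tendsto (fun s => classicalGrad (lensWave γ Q s) x) (𝓝 t)
      (𝓝 (classicalGrad (lensWave γ Q t) x)) := by
  have hA := (hasDerivAt_lensAmplitude (n := n) hγ hc).continuousAt
  have hT := (hasDerivAt_tan_mul hc).continuousAt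
  have hC := (hasDerivAt_cos_inv hc).continuousAt
  have hx : ContinuousAt (fun s => (Real.cos (2 * γ * s))⁻¹ • x) t := hC.smul_const x
  have hq : ContinuousAt (fun s => Q ((Real.cos (2 * γ * s))⁻¹ • x)) t :=
    ContinuousAt.comp (g := Q) hQ.contDiff.continuous.continuousAt hx
  have hd : ContinuousAt (fun s => fderiv ℝ Q ((Real.cos (2 * γ * s))⁻¹ • x)) t :=
    ContinuousAt.comp (g := fderiv ℝ Q)
      (hQ.contDiff_one.continuous_fderiv one_ne_zero).continuousAt hx
  have hofReal : ∀ f : ℝ → ℝ, ContinuousAt f t → ContinuousAt (fun s => (f s : ℂ)) t :=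
    fun f hf => ContinuousAt.comp (g := Complex.ofReal) Complex.continuous_ofReal.continuousAt hf
  have hj : ∀ j, ContinuousAt (fun s => classicalGrad (lensWave γ Q s) x j) t := by
    intro j
    simp only [lensWave, classicalGrad_chirp hQ.contDiff]
    have hD := hd.clm_apply (continuousAt_const (y := EuclideanSpace.single j (1 : ℝ)))
    exact (hA.mul (continuousAt_const.mul (hofReal _
      ((continuousAt_const.mul hT).mul continuousAt_const))).cexp).mul ((hofReal _ (hC.mul hD)).add
        ((continuousAt_const.mul (hofReal _ ((continuousAt_const.mul
          (continuousAt_const.mul hT)).mul continuousAt_const))).mul (hofReal _ hq)))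
  exact ((PiLp.continuous_toLp 2 _).tendsto _).comp (tendsto_pi_nhds.2 hj)

theorem memWeightedSobolev_lensWave (hQ : IsGroundState Q) (hn : 1 ≤ n)
    (hc : 0 < Real.cos (2 * γ * t)) : MemWeightedSobolev (lensWave γ Q t) := by
  have hw := norm_lensAmplitude_sq (n := n) hc
  refine ⟨(hQ.memLp_chirp (inv_pos.2 hc) hw).1, ?_,
    (hQ.memLp_norm_smul_chirp hn (inv_pos.2 hc) hw).1⟩
  rw [gradNorm_eq_eLpNorm_classicalGrad ((contDiff_lensWave hQ γ t).of_le one_le_two)]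
  exact (hQ.memLp_grad_chirp hn (inv_pos.2 hc) hw).1.2

theorem gradNorm_lensWave (hQ : IsGroundState Q) (hn : 1 ≤ n) (hc : 0 < Real.cos (2 * γ * t)) :
    gradNorm (lensWave γ Q t) = ENNReal.ofReal (√((Real.cos (2 * γ * t))⁻¹ ^ 2
        * (∫ x, ‖classicalGrad (fun y => (Q y : ℂ)) x‖ ^ 2)
      + γ ^ 2 * Real.sin (2 * γ * t) ^ 2 * ∫ x, ‖x‖ ^ 2 * Q x ^ 2)) := by
  rw [gradNorm_eq_eLpNorm_classicalGrad ((contDiff_lensWave hQ γ t).of_le one_le_two)]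
  refine (hQ.memLp_grad_chirp hn (inv_pos.2 hc) (norm_lensAmplitude_sq hc)).2.trans ?_
  congr 4
  have hne := hc.ne'
  rw [Real.tan_eq_sin_div_cos]
  generalize Real.cos (2 * γ * t) = y at *
  generalize Real.sin (2 * γ * t) = z
  field_simp
  ring

/-- The curve `t ↦ u(t)` is continuous in `ℋ¹`: the wave and its gradient depend continuously on
time pointwise, and so do the `L²` norms. -/
theorem continuousInWeightedSobolev_lensWave (hQ : IsGroundState Q) (hn : 1 ≤ n) (hγ : 0 < γ) :
    ContinuousInWeightedSobolev (Real.pi / (4 * γ)) (lensWave γ Q) := by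
  refine ⟨fun t ht => memWeightedSobolev_lensWave hQ hn (cos_pos_of_mem_Ico hγ ht), ?_⟩
  intro t ht
  have hc := cos_pos_of_mem_Ico hγ ht
  have hw := norm_lensAmplitude_sq (n := n) hc
  have hmem := memWeightedSobolev_lensWave hQ hn hc
  have hC1 : ∀ s, ContDiff ℝ 1 (lensWave γ Q s) := fun s =>
    (contDiff_lensWave hQ γ s).of_le one_le_two
  have hpt : ∀ x, Tendsto (fun s => lensWave γ Q s x) (𝓝[Ico 0 (Real.pi / (4 * γ))] t)
      (𝓝 (lensWave γ Q t x)) := fun x =>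
    (hasDerivAt_lensWave hQ hγ hc x).continuousAt.continuousWithinAt
  have hcosinv : ContinuousAt (fun s => (Real.cos (2 * γ * s))⁻¹) t :=
    (hasDerivAt_cos_inv hc).continuousAt
  have hev : ∀ᶠ s in 𝓝[Ico 0 (Real.pi / (4 * γ))] t, 0 < Real.cos (2 * γ * s) :=
    eventually_mem_nhdsWithin.mono fun s hs => cos_pos_of_mem_Ico hγ hs
  have h1 : Tendsto (fun s => eLpNorm (lensWave γ Q s - lensWave γ Q t) 2 volume)
      (𝓝[Ico 0 (Real.pi / (4 * γ))] t) (𝓝 0) := by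
    refine tendsto_eLpNorm_two_sub_of_tendsto
      (fun s => (hC1 s).continuous.aestronglyMeasurable) hmem.1 hpt ?_
    refine tendsto_const_nhds.congr' (hev.mono fun s hs => ?_)
    exact (hQ.memLp_chirp (inv_pos.2 hc) hw).2.trans
      (hQ.memLp_chirp (inv_pos.2 hs) (norm_lensAmplitude_sq hs)).2.symm
  have h2 : Tendsto (fun s => eLpNorm (fun x => ‖x‖ • (lensWave γ Q s - lensWave γ Q t) x) 2 volume)
      (𝓝[Ico 0 (Real.pi / (4 * γ))] t) (𝓝 0) := by
    have hsub : ∀ s, (fun x => ‖x‖ • (lensWave γ Q s - lensWave γ Q t) x)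
        = (fun x => ‖x‖ • lensWave γ Q s x) - fun x => ‖x‖ • lensWave γ Q t x := by
      intro s
      ext x
      simp [mul_sub]
    simp only [hsub]
    refine tendsto_eLpNorm_two_sub_of_tendsto
      (fun s => (continuous_norm.smul (hC1 s).continuous).aestronglyMeasurable) hmem.2.2
      (fun x => (hpt x).const_smul _) ?_
    have e : eLpNorm (fun x => ‖x‖ • lensWave γ Q t x) 2 volume = _ :=
      (hQ.memLp_norm_smul_chirp hn (inv_pos.2 hc) hw).2
    rw [e]
    refine Tendsto.congr' (hev.mono fun s hs => ((hQ.memLp_norm_smul_chirp hn (inv_pos.2 hs)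
      (norm_lensAmplitude_sq hs)).2).symm) ?_
    refine (ENNReal.continuous_ofReal.tendsto _).comp ?_
    refine (Real.continuous_sqrt.tendsto _).comp ?_
    exact (tendsto_const_nhds.div (hcosinv.pow 2)
      (pow_pos (inv_pos.2 hc) 2).ne').mono_left nhdsWithin_le_nhds
  have h3 : Tendsto (fun s => gradNorm (lensWave γ Q s - lensWave γ Q t))
      (𝓝[Ico 0 (Real.pi / (4 * γ))] t) (𝓝 0) := by
    have hsub : ∀ s, gradNorm (lensWave γ Q s - lensWave γ Q t)
        = eLpNorm (classicalGrad (lensWave γ Q s) - classicalGrad (lensWave γ Q t)) 2 volume := by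
      intro s
      have hst : ContDiff ℝ 1 (lensWave γ Q s - lensWave γ Q t) := (hC1 s).sub (hC1 t)
      rw [gradNorm_eq_eLpNorm_classicalGrad hst, classicalGrad_sub (hC1 s) (hC1 t)]
    simp only [hsub]
    refine tendsto_eLpNorm_two_sub_of_tendsto
      (fun s => (continuous_classicalGrad (hC1 s)).aestronglyMeasurable)
      (hQ.memLp_grad_chirp hn (inv_pos.2 hc) hw).1
      (fun x => (tendsto_classicalGrad_lensWave hQ hγ hc x).mono_left nhdsWithin_le_nhds) ?_
    simp only [← gradNorm_eq_eLpNorm_classicalGrad (hC1 _)]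
    rw [gradNorm_lensWave hQ hn hc]
    refine Tendsto.congr' (hev.mono fun s hs => (gradNorm_lensWave hQ hn hs).symm) ?_
    refine (ENNReal.continuous_ofReal.tendsto _).comp ?_
    refine (Real.continuous_sqrt.tendsto _).comp ?_
    have hsin : ContinuousAt (fun s => Real.sin (2 * γ * s)) t := by fun_prop
    exact (((hcosinv.pow 2).mul_const _).add (((hsin.pow 2).const_mul _).mul_const _)).mono_left
      nhdsWithin_le_nhds
  simpa [weightedNorm] using (h3.add h2).add h1

/-! ### The blowup rate -/

theorem isEquivalent_gradNorm_lensWave (hQ : IsGroundState Q) (hn : 1 ≤ n) (hγ : 0 < γ) :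
    (fun t => (gradNorm (lensWave γ Q t)).toReal) ~[𝓝[<] (Real.pi / (4 * γ))]
      (fun t => (gradNorm fun x => (Q x : ℂ)).toReal / (Real.pi / 2 - 2 * γ * t)) := by
  set G := ∫ x, ‖classicalGrad (fun y => (Q y : ℂ)) x‖ ^ 2 with hG
  set K := ∫ x, ‖x‖ ^ 2 * Q x ^ 2
  have hGpos : 0 < G := hQ.integral_grad_sq_pos hn
  have hTpos : 0 < Real.pi / (4 * γ) := by have := Real.pi_pos; positivity
  have hev : ∀ᶠ t in 𝓝[<] (Real.pi / (4 * γ)), t ∈ Ico 0 (Real.pi / (4 * γ)) :=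
    Ico_mem_nhdsLT hTpos
  have hQG : (gradNorm fun x => (Q x : ℂ)).toReal = √G := by
    rw [gradNorm_eq_eLpNorm_classicalGrad (hQ.contDiff_ofReal.of_le one_le_two),
      eLpNorm_two_eq_ofReal_sqrt hQ.memLp_grad, ENNReal.toReal_ofReal (Real.sqrt_nonneg _)]
  have hδpos : ∀ t ∈ Ico 0 (Real.pi / (4 * γ)), 0 < Real.pi / 2 - 2 * γ * t := by
    intro t ht
    have h2 : t * (4 * γ) < Real.pi := (lt_div_iff₀ (by positivity)).1 ht.2
    linarith
  have hδ : Tendsto (fun t => Real.pi / 2 - 2 * γ * t) (𝓝[<] (Real.pi / (4 * γ))) (𝓝 0) := by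
    have h : Continuous fun t => Real.pi / 2 - 2 * γ * t := by fun_prop
    have h1 := h.tendsto (Real.pi / (4 * γ))
    have h2 : Real.pi / 2 - 2 * γ * (Real.pi / (4 * γ)) = 0 := by
      field_simp
      norm_num
    rw [h2] at h1
    exact h1.mono_left nhdsWithin_le_nhds
  -- `δ / cos(2γt) = δ / sin δ → 1` with `δ = π/2 - 2γt`
  have hratio : Tendsto (fun t => (Real.sinc (Real.pi / 2 - 2 * γ * t))⁻¹)
      (𝓝[<] (Real.pi / (4 * γ))) (𝓝 1) := by
    have := ((Real.continuous_sinc.tendsto 0).comp hδ).inv₀ (by simp)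
    simpa [Function.comp_def] using this
  have hsin : Tendsto (fun t => Real.sin (2 * γ * t)) (𝓝[<] (Real.pi / (4 * γ)))
      (𝓝 (Real.sin (2 * γ * (Real.pi / (4 * γ))))) :=
    ((by fun_prop : Continuous fun t => Real.sin (2 * γ * t)).tendsto _).mono_left
      nhdsWithin_le_nhds
  rw [isEquivalent_iff_tendsto_one]
  · have hlim : Tendsto (fun t => √((Real.sinc (Real.pi / 2 - 2 * γ * t))⁻¹ ^ 2
        + γ ^ 2 * Real.sin (2 * γ * t) ^ 2 * (Real.pi / 2 - 2 * γ * t) ^ 2 * (K / G)))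
        (𝓝[<] (Real.pi / (4 * γ))) (𝓝 1) := by
      have h := (hratio.pow 2).add ((((hsin.pow 2).const_mul (γ ^ 2)).mul (hδ.pow 2)).mul_const
        (K / G))
      have h' := (Real.continuous_sqrt.tendsto _).comp h
      simpa [Function.comp_def] using h'
    refine hlim.congr' (hev.mono fun t ht => ?_)
    have hd := hδpos t ht
    have hc := cos_pos_of_mem_Ico hγ ht
    simp only [Pi.div_apply]
    rw [gradNorm_lensWave hQ hn hc, ENNReal.toReal_ofReal (Real.sqrt_nonneg _), hQG,
      Real.sinc_of_ne_zero hd.ne', Real.sin_pi_div_two_sub]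
    have hsq : √G / (Real.pi / 2 - 2 * γ * t) = √(G / (Real.pi / 2 - 2 * γ * t) ^ 2) := by
      rw [Real.sqrt_div hGpos.le, Real.sqrt_sq hd.le]
    rw [hsq, ← Real.sqrt_div' _ (by positivity)]
    congr 1
    field_simp
    rfl
  · filter_upwards [hev] with t ht
    rw [hQG]
    exact (div_pos (Real.sqrt_pos.2 hGpos) (hδpos t ht)).ne'

theorem tendsto_gradNorm_lensWave (hQ : IsGroundState Q) (hn : 1 ≤ n) (hγ : 0 < γ) :
    Tendsto (fun t => gradNorm (lensWave γ Q t)) (𝓝[<] (Real.pi / (4 * γ))) (𝓝 ⊤) := by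
  have hTpos : 0 < Real.pi / (4 * γ) := by have := Real.pi_pos; positivity
  have hev : ∀ᶠ t in 𝓝[<] (Real.pi / (4 * γ)), t ∈ Ico 0 (Real.pi / (4 * γ)) :=
    Ico_mem_nhdsLT hTpos
  have hcos : Tendsto (fun t => (Real.cos (2 * γ * t))⁻¹) (𝓝[<] (Real.pi / (4 * γ))) atTop := by
    refine tendsto_inv_nhdsGT_zero.comp (tendsto_nhdsWithin_iff.2
      ⟨?_, hev.mono fun t ht => cos_pos_of_mem_Ico hγ ht⟩)
    have h := ((by fun_prop : Continuous fun t => Real.cos (2 * γ * t)).tendsto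
      (Real.pi / (4 * γ)))
    have h2 : 2 * γ * (Real.pi / (4 * γ)) = Real.pi / 2 := by
      field_simp
      norm_num
    rw [h2, Real.cos_pi_div_two] at h
    exact h.mono_left nhdsWithin_le_nhds
  have hG := hQ.integral_grad_sq_pos hn
  refine tendsto_nhds_top_mono (ENNReal.tendsto_ofReal_atTop.comp
    (hcos.atTop_mul_const (Real.sqrt_pos.2 hG))) (hev.mono fun t ht => ?_)
  have hc := cos_pos_of_mem_Ico hγ ht
  beta_reduce
  rw [Function.comp_apply, gradNorm_lensWave hQ hn hc]
  refine ENNReal.ofReal_le_ofReal (Real.le_sqrt_of_sq_le ?_)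
  rw [mul_pow, Real.sq_sqrt hG.le]
  have : 0 ≤ ∫ x, ‖x‖ ^ 2 * Q x ^ 2 := integral_nonneg fun x => by positivity
  exact le_add_of_nonneg_right (by positivity)

/-! ### Rigidity of the quadratic phase -/

/-- Positive functions times a constant and a quadratic phase determine the phase: otherwise
`exp(-i (b - b') |x|²)` would be a positive real number for every `x`. -/
theorem quadraticPhase_unique (hn : 1 ≤ n) {w w' : ℂ} (hw : w ≠ 0) {b b' : ℝ}
    {q q' : Space n → ℝ} (hq : ∀ x, 0 < q x) (hq' : ∀ x, 0 < q' x)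
    (h : ∀ x : Space n, w * Complex.exp (-Complex.I * ((b * ‖x‖ ^ 2 : ℝ) : ℂ)) * (q x : ℂ)
      = w' * Complex.exp (-Complex.I * ((b' * ‖x‖ ^ 2 : ℝ) : ℂ)) * (q' x : ℂ)) : b = b' := by
  by_contra hne
  -- a point where the two phases are opposite
  set x : Space n := EuclideanSpace.single ⟨0, hn⟩ (√(Real.pi / |b - b'|)) with hx
  have hxn : ‖x‖ ^ 2 = Real.pi / |b - b'| := by
    rw [hx, PiLp.norm_single, Real.norm_of_nonneg (Real.sqrt_nonneg _), Real.sq_sqrt]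
    have := Real.pi_pos
    positivity
  have hexp : Complex.exp (-Complex.I * ((b * ‖x‖ ^ 2 : ℝ) : ℂ))
      = -Complex.exp (-Complex.I * ((b' * ‖x‖ ^ 2 : ℝ) : ℂ)) := by
    have h1 : b * ‖x‖ ^ 2 = b' * ‖x‖ ^ 2 + (b - b') * ‖x‖ ^ 2 := by ring
    have h2 : Complex.exp (-Complex.I * (((b - b') * ‖x‖ ^ 2 : ℝ) : ℂ)) = -1 := by
      rw [hxn]
      rcases abs_choice (b - b') with ha | ha
      · rw [ha, mul_div_cancel₀ _ (sub_ne_zero.2 hne), neg_mul, Complex.exp_neg, mul_comm,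
          Complex.exp_pi_mul_I]
        norm_num
      · rw [ha, div_neg, mul_neg, mul_div_cancel₀ _ (sub_ne_zero.2 hne), Complex.ofReal_neg,
          neg_mul_neg, mul_comm, Complex.exp_pi_mul_I]
    rw [h1, Complex.ofReal_add, mul_add, Complex.exp_add, h2, mul_neg_one]
  have h0 := h 0
  have hx' := h x
  rw [hexp] at hx'
  simp only [norm_zero, ne_eq, OfNat.ofNat_ne_zero, not_false_eq_true, zero_pow, mul_zero,
    Complex.ofReal_zero, Complex.exp_zero, mul_one] at h0
  have hE := Complex.exp_ne_zero (-Complex.I * ((b' * ‖x‖ ^ 2 : ℝ) : ℂ))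
  have h3 : w * Complex.exp (-Complex.I * ((b' * ‖x‖ ^ 2 : ℝ) : ℂ))
      * ((q x * q' 0 + q 0 * q' x : ℝ) : ℂ) = 0 := by
    generalize Complex.exp (-Complex.I * ((b' * ‖x‖ ^ 2 : ℝ) : ℂ)) = E at *
    push_cast
    linear_combination (-(q' 0 : ℂ)) * hx'
      + (E * q' x) * h0
  have h4 : q x * q' 0 + q 0 * q' x ≠ 0 :=
    (add_pos (mul_pos (hq x) (hq' 0)) (mul_pos (hq 0) (hq' x))).ne'
  exact mul_ne_zero (mul_ne_zero hw hE) (Complex.ofReal_ne_zero.2 h4) h3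

theorem continuous_minimalMassProfile (hQ : Continuous Q) (γ : ℝ) (M : Matrix (Fin n) (Fin n) ℝ)
    (T κ θ : ℝ) (x₁ : Space n) (t : ℝ) : Continuous (minimalMassProfile γ M Q T κ θ x₁ t) := by
  have h : Continuous (mulMat (NormedSpace.exp (t • M))) :=
    (Matrix.toEuclideanLin (NormedSpace.exp (t • M))).continuous_of_finiteDimensional
  have hofReal : Continuous Complex.ofReal := Complex.continuous_ofReal
  unfold minimalMassProfile
  fun_prop

/-- The quadratic phases `tan(2γt)` and `cot(2γ(T - t))` agree only if `2γT = π/2`. -/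
theorem lensWave_not_ae_eq_minimalMassProfile (hQ : IsGroundState Q) (hn : 1 ≤ n) (hγ : 0 < γ)
    (M : Matrix (Fin n) (Fin n) ℝ) {T : ℝ} (hT : T < Real.pi / (4 * γ))
    (κ θ : ℝ) (x₁ : Space n) (ht : t ∈ Ico 0 T) :
    ¬ lensWave γ Q t =ᵐ[volume] minimalMassProfile γ M Q T κ θ x₁ t := by
  intro hae
  have hct := cos_pos_of_mem_Ico hγ ⟨ht.1, ht.2.trans hT⟩
  have hcT := cos_pos_of_mem_Ico hγ ⟨ht.1.trans ht.2.le, hT⟩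
  have hsin : 0 < Real.sin (2 * γ * (T - t)) := by
    have h2 : T * (4 * γ) < Real.pi := (lt_div_iff₀ (by positivity)).1 hT
    have h3 : 0 < γ * (T - t) := mul_pos hγ (sub_pos.2 ht.2)
    have h4 : 0 ≤ γ * t := mul_nonneg hγ.le ht.1
    exact Real.sin_pos_of_pos_of_lt_pi (by linarith) (by linarith [Real.pi_pos])
  have heq := (Continuous.ae_eq_iff_eq volume (contDiff_lensWave hQ γ t).continuous
    (continuous_minimalMassProfile hQ.contDiff.continuous γ M T κ θ x₁ t)).1 hae
  set a : ℝ := 2 * γ * Real.cos (2 * γ * T) / Real.sin (2 * γ * (T - t)) with ha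
  have hw : lensAmplitude n γ t ≠ 0 := by
    rw [← norm_ne_zero_iff, norm_lensAmplitude hct]
    positivity
  have hb := quadraticPhase_unique hn hw (b := γ / 2 * Real.tan (2 * γ * t))
    (b' := γ / 2 * Real.cot (2 * γ * (T - t)))
    (w' := Complex.exp (Complex.I * (θ : ℂ)) * (((κ * a) ^ ((n : ℝ) / 2) : ℝ) : ℂ)
      * Complex.exp (Complex.I * ((κ ^ 2 * a * Real.cos (2 * γ * t) : ℝ) : ℂ)))
    (q := fun x => Q ((Real.cos (2 * γ * t))⁻¹ • x))
    (q' := fun x => Q ((κ * a) • mulMat (NormedSpace.exp (t • M)) x - x₁))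
    (fun x => hQ.pos _) (fun x => hQ.pos _) fun x => by
      refine (congrFun heq x).trans ?_
      simp only [minimalMassProfile, ← ha]
      rw [mul_right_comm (γ / 2)]
      ring
  have htc : Real.tan (2 * γ * t) = Real.cot (2 * γ * (T - t)) :=
    mul_left_cancel₀ (by positivity) hb
  rw [Real.tan_eq_sin_div_cos, Real.cot_eq_cos_div_sin, div_eq_div_iff hct.ne' hsin.ne'] at htc
  have hadd : Real.cos (2 * γ * T) = Real.cos (2 * γ * t) * Real.cos (2 * γ * (T - t))
      - Real.sin (2 * γ * t) * Real.sin (2 * γ * (T - t)) := by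
    rw [← Real.cos_add]
    congr 1
    ring
  rw [hadd] at hcT
  linarith

end RotNLS

end

theorem mainTheorem4 (n : ℕ) (hn : 1 ≤ n) (γ : ℝ) (hγ : 0 < γ)
    (M : Matrix (Fin n) (Fin n) ℝ) (hM : M.transpose = -M)
    (Q : RotNLS.Space n → ℝ) (hQ : RotNLS.IsGroundState Q)
    (u : ℝ → RotNLS.Space n → ℂ)
    (hu : u = RotNLS.rTransform γ M (RotNLS.solitaryWave Q)) :
    -- the explicit formula, and the initial value
    (∀ t ∈ Ico 0 (Real.pi / (4 * γ)), ∀ x : RotNLS.Space n,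
      u t x = ((1 / Real.cos (2 * γ * t) ^ ((n : ℝ) / 2) : ℝ) : ℂ)
        * Complex.exp (-Complex.I * ((γ / 2 * ‖x‖ ^ 2 * Real.tan (2 * γ * t) : ℝ) : ℂ))
        * Complex.exp (Complex.I * ((Real.tan (2 * γ * t) / (2 * γ) : ℝ) : ℂ))
        * (Q ((Real.cos (2 * γ * t))⁻¹ • RotNLS.mulMat (NormedSpace.exp (t • M)) x) : ℂ)) ∧
    (∀ x, u 0 x = (Q x : ℂ)) ∧
    -- it solves the rotational NLS on `[0, π/(4γ))`
    RotNLS.IsSolution γ M (Real.pi / (4 * γ)) u ∧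
    -- it has the mass of `Q`
    (∀ t ∈ Ico 0 (Real.pi / (4 * γ)),
      eLpNorm (u t) 2 volume = eLpNorm Q 2 volume) ∧
    -- it blows up at `π/(4γ)`, at the stated rate
    Tendsto (fun t => RotNLS.gradNorm (u t)) (𝓝[<] (Real.pi / (4 * γ))) (𝓝 ⊤) ∧
    (fun t => (RotNLS.gradNorm (u t)).toReal) ~[𝓝[<] (Real.pi / (4 * γ))]
      (fun t => (RotNLS.gradNorm fun x => (Q x : ℂ)).toReal / (Real.pi / 2 - 2 * γ * t)) ∧
    -- at no time does it have the form of a minimal mass profile with an earlier blowup time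
    (∀ T : ℝ, 0 < T → T < Real.pi / (4 * γ) →
      ∀ (κ θ : ℝ) (x₁ : RotNLS.Space n), 0 < κ → ∀ t ∈ Ico 0 T,
        ¬ (u t =ᵐ[volume] RotNLS.minimalMassProfile γ M Q T κ θ x₁ t)) := by
  have hlens : u = RotNLS.lensWave γ Q :=
    hu.trans (RotNLS.rTransform_solitaryWave_eq_lensWave hQ hM)
  have hmass : ∀ t ∈ Ico 0 (Real.pi / (4 * γ)), eLpNorm (u t) 2 volume = eLpNorm Q 2 volume := by
    intro t ht
    have hc := RotNLS.cos_pos_of_mem_Ico hγ ht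
    rw [RotNLS.eLpNorm_two_eq_ofReal_sqrt hQ.memLp, hlens]
    simp only [Real.norm_eq_abs, sq_abs]
    exact (hQ.memLp_chirp (inv_pos.2 hc) (RotNLS.norm_lensAmplitude_sq hc)).2
  refine ⟨?_, ?_, ⟨?_, ?_, RotNLS.lensWaveDeriv γ Q,
    RotNLS.continuousOn_lensWaveDeriv hQ hγ, ?_⟩, hmass, ?_, ?_, ?_⟩
  · intro t _ x
    rw [hu, RotNLS.rTransform, RotNLS.solitaryWave]
    ring
  · intro x
    simp [hlens, RotNLS.lensWave, RotNLS.chirp, RotNLS.lensAmplitude]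
  · rw [hlens]
    exact RotNLS.continuousInWeightedSobolev_lensWave hQ hn hγ
  · intro t _
    rw [hlens]
    exact RotNLS.contDiff_lensWave hQ γ t
  · intro t ht x
    have hc := RotNLS.cos_pos_of_mem_Ico hγ ht
    rw [hlens]
    refine ⟨(RotNLS.hasDerivAt_lensWave hQ hγ hc x).hasDerivWithinAt, ?_⟩
    rw [RotNLS.fderiv_radial_eq_zero
      ((RotNLS.contDiff_lensWave hQ γ t).differentiable two_ne_zero x)
      (RotNLS.lensWave_radial hQ γ t) (RotNLS.inner_mulMat_self_of_skew hM x), mul_zero, add_zero]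
    exact RotNLS.lensWave_equation hQ hn hc x
  · rw [hlens]
    exact RotNLS.tendsto_gradNorm_lensWave hQ hn hγ
  · rw [hlens]
    exact RotNLS.isEquivalent_gradNorm_lensWave hQ hn hγ
  · intro T _ hT κ θ x₁ _ t ht
    rw [hlens]
    exact RotNLS.lensWave_not_ae_eq_minimalMassProfile hQ hn hγ M hT κ θ x₁ ht
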